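/- Let $k$ be a field containing a primitive third root of unity $r$, and let $A$ be the Hopf algebra over $k$ generated by $a,b,x,y$ subject to $$ba=ab,\quad ya=ay,\quad bx=xb,\quad yx=xy,\quad by=-yb,$$ $$x+axa^2+a^2xa-a+1=0,\qquad x^2+ax^2a^2+xaxa^2+x+axa^2=0,$$ $$y^2=x^2+x^3,\qquad b^2=a^3=1,\qquad F^3=0,$$ where $F:=xa+(r+1)ax+\frac{r+2}{3}(a-a^2)$, with $\Delta(a)=a\otimes a$, $\Delta(b)=b\otimes b$, $\Delta(x)=1\otimes x+x\otimes a$, $\Delta(y)=1\otimes y+y\otimes b$ (so the counit is $\varepsilon(a)=\varepsilon(b)=1$, $\varepsilon(x)=\varepsilon(y)=0$). Put $K:=a^2$, $E:=xa-r\,ax+\frac{1-r}{3}(a-a^2)$, and let $$\Omega:=EF+\frac{r^2K+rK^2}{(r-r^2)^2}$$ be the Casimir element. Then: 1. $A$ is left and right Noetherian, and its Gelfand–Kirillov dimension over $k$ is $1$. 2. $A$ is not regular: neither its left nor its right global dimension is finite. Indeed the trivial module ($k$ with $A$ acting through $\varepsilon$), both as a left and as a right module, has infinite projective dimension. More precisely,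 $s\mapsto x$, $t\mapsto y$ defines an injective algebra map from the coordinate ring $k[s,t]/(t^2-s^2-s^3)$ of the nodal cubic to $A$; along it $\varepsilon$ restricts to evaluation at the singular point $(0,0)$, and the restriction of the trivial left $A$-module already has infinite projective dimension over the coordinate ring. 3. $A$ is not semiprime (that is, it has a nonzero nilpotent two-sided ideal). Indeed $\Omega$ is central with minimal polynomial $(t-\tfrac13)^2(t+\tfrac23)$ over $k$, and the ideal of $A$ generated by $(\Omega-\tfrac13)(\Omega+\tfrac23)$ is two-sided, nonzero and nilpotent. -/

import Mathlib

open scoped TensorProduct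
open CategoryTheory

universe u

namespace NodalCubic

/-- The four generators of the algebra. -/
inductive Gen : Type
  | a | b | x | y

section Elements

variable {k : Type u} [Field k] {T : Type*} [Ring T] [Algebra k T]

/-- `F = xa + (r+1)ax + (r+2)/3 (a - a²)`, evaluated at elements `a`, `x` of an algebra. -/
def elemF (r : k) (a x : T) : T :=
  x * a + (r + 1) • (a * x) + ((r + 2) / 3) • (a - a ^ 2)

/-- `E = xa - r ax + (1-r)/3 (a - a²)`, evaluated at elements `a`, `x` of an algebra. -/
def elemE (r : k) (a x : T) : T :=
  x * a - r • (a * x) + ((1 - r) / 3) • (a - a ^ 2)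

end Elements

/-- The defining relations, on the free algebra `k⟨a, b, x, y⟩`. -/
inductive Rel {k : Type u} [Field k] (r : k) : FreeAlgebra k Gen → FreeAlgebra k Gen → Prop
  | ba : Rel r (.ι k .b * .ι k .a) (.ι k .a * .ι k .b)
  | ya : Rel r (.ι k .y * .ι k .a) (.ι k .a * .ι k .y)
  | bx : Rel r (.ι k .b * .ι k .x) (.ι k .x * .ι k .b)
  | yx : Rel r (.ι k .y * .ι k .x) (.ι k .x * .ι k .y)
  | byy : Rel r (.ι k .b * .ι k .y) (-(.ι k .y * .ι k .b))
  | ax1 : Rel r (.ι k .x + .ι k .a * .ι k .x * .ι k .a ^ 2 + .ι k .a ^ 2 * .ι k .x * .ι k .a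
      - .ι k .a + 1) 0
  | ax2 : Rel r (.ι k .x ^ 2 + .ι k .a * .ι k .x ^ 2 * .ι k .a ^ 2
      + .ι k .x * .ι k .a * .ι k .x * .ι k .a ^ 2 + .ι k .x + .ι k .a * .ι k .x * .ι k .a ^ 2) 0
  | cubic : Rel r (.ι k .y ^ 2) (.ι k .x ^ 2 + .ι k .x ^ 3)
  | bb : Rel r (.ι k .b ^ 2) 1
  | aaa : Rel r (.ι k .a ^ 3) 1
  | FFF : Rel r (elemF r (.ι k .a) (.ι k .x) ^ 3) 0

/-- The algebra `A` generated by `a, b, x, y` with the relations above. It depends only on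
`k` and on the primitive third root of unity `r`. -/
def A {k : Type u} [Field k] {r : k} (_hr : IsPrimitiveRoot r 3) : Type u :=
  RingQuot (Rel r)

section Algebra

variable {k : Type u} [Field k] {r : k} (hr : IsPrimitiveRoot r 3)

noncomputable instance : Ring (A hr) := inferInstanceAs (Ring (RingQuot (Rel r)))

noncomputable instance : Algebra k (A hr) := inferInstanceAs (Algebra k (RingQuot (Rel r)))

/-- The quotient map from the free algebra. -/
noncomputable def A.mk : FreeAlgebra k Gen →ₐ[k] A hr := RingQuot.mkAlgHom k (Rel r)

/-- The generator `a` of `A`. -/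
noncomputable def A.a : A hr := A.mk hr (.ι k .a)

/-- The generator `b` of `A`. -/
noncomputable def A.b : A hr := A.mk hr (.ι k .b)

/-- The generator `x` of `A`. -/
noncomputable def A.x : A hr := A.mk hr (.ι k .x)

/-- The generator `y` of `A`. -/
noncomputable def A.y : A hr := A.mk hr (.ι k .y)

/-- The relations of `A`, as conditions on four elements of an arbitrary `k`-algebra. -/
structure Satisfies {T : Type*} [Ring T] [Algebra k T] (r : k) (a b x y : T) : Prop where
  ba : b * a = a * b
  ya : y * a = a * y
  bx : b * x = x * b
  yx : y * x = x * y
  byy : b * y = -(y * b)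
  ax1 : x + a * x * a ^ 2 + a ^ 2 * x * a - a + 1 = 0
  ax2 : x ^ 2 + a * x ^ 2 * a ^ 2 + x * a * x * a ^ 2 + x + a * x * a ^ 2 = 0
  cubic : y ^ 2 = x ^ 2 + x ^ 3
  bb : b ^ 2 = 1
  aaa : a ^ 3 = 1
  FFF : elemF r a x ^ 3 = 0

theorem A.mk_surjective : Function.Surjective (A.mk hr) :=
  RingQuot.mkAlgHom_surjective k (Rel r)

theorem A.map_elemF {S T : Type*} [Ring S] [Algebra k S] [Ring T] [Algebra k T]
    (f : S →ₐ[k] T) (a x : S) : f (elemF r a x) = elemF r (f a) (f x) := by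
  simp [elemF]

theorem A.satisfies : Satisfies r (A.a hr) (A.b hr) (A.x hr) (A.y hr) := by
  have key : ∀ {s t : FreeAlgebra k Gen}, Rel r s t → A.mk hr s = A.mk hr t :=
    fun h => RingQuot.mkAlgHom_rel k h
  constructor
  · simpa [A.a, A.b, A.x, A.y] using key .ba
  · simpa [A.a, A.b, A.x, A.y] using key .ya
  · simpa [A.a, A.b, A.x, A.y] using key .bx
  · simpa [A.a, A.b, A.x, A.y] using key .yx
  · simpa [A.a, A.b, A.x, A.y] using key .byy
  · simpa [A.a, A.b, A.x, A.y] using key .ax1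
  · simpa [A.a, A.b, A.x, A.y] using key .ax2
  · simpa [A.a, A.b, A.x, A.y] using key .cubic
  · simpa [A.a, A.b, A.x, A.y] using key .bb
  · simpa [A.a, A.b, A.x, A.y] using key .aaa
  · simpa [A.map_elemF, A.a, A.x] using key .FFF

/-- The values of an algebra map on the four generators. -/
def Gen.val {T : Type*} (a b x y : T) : Gen → T
  | .a => a
  | .b => b
  | .x => x
  | .y => y

/-- The universal property of `A`. -/
noncomputable def A.lift {T : Type*} [Ring T] [Algebra k T] (a b x y : T)
    (h : Satisfies r a b x y) : A hr →ₐ[k] T :=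
  RingQuot.liftAlgHom k ⟨FreeAlgebra.lift k (Gen.val a b x y), by
    intro s t hst
    cases hst
    · simpa [Gen.val] using h.ba
    · simpa [Gen.val] using h.ya
    · simpa [Gen.val] using h.bx
    · simpa [Gen.val] using h.yx
    · simpa [Gen.val] using h.byy
    · simpa [Gen.val] using h.ax1
    · simpa [Gen.val] using h.ax2
    · simpa [Gen.val] using h.cubic
    · simpa [Gen.val] using h.bb
    · simpa [Gen.val] using h.aaa
    · simpa [A.map_elemF, Gen.val] using h.FFF⟩

section Lift

variable {T : Type*} [Ring T] [Algebra k T] (a b x y : T) (h : Satisfies r a b x y)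

theorem A.lift_mk (s : FreeAlgebra k Gen) :
    A.lift hr a b x y h (A.mk hr s) = FreeAlgebra.lift k (Gen.val a b x y) s :=
  RingQuot.liftAlgHom_mkAlgHom_apply ..

@[simp] theorem A.lift_a : A.lift hr a b x y h (A.a hr) = a := by
  simp [A.a, A.lift_mk, Gen.val]
@[simp] theorem A.lift_b : A.lift hr a b x y h (A.b hr) = b := by
  simp [A.b, A.lift_mk, Gen.val]
@[simp] theorem A.lift_x : A.lift hr a b x y h (A.x hr) = x := by
  simp [A.x, A.lift_mk, Gen.val]
@[simp] theorem A.lift_y : A.lift hr a b x y h (A.y hr) = y := by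
  simp [A.y, A.lift_mk, Gen.val]

end Lift

theorem A.hom_ext {T : Type*} [Ring T] [Algebra k T] {f g : A hr →ₐ[k] T}
    (ha : f (A.a hr) = g (A.a hr)) (hb : f (A.b hr) = g (A.b hr))
    (hx : f (A.x hr) = g (A.x hr)) (hy : f (A.y hr) = g (A.y hr)) : f = g := by
  have : f.comp (A.mk hr) = g.comp (A.mk hr) := by
    apply FreeAlgebra.hom_ext
    funext i
    cases i <;> assumption
  ext z
  obtain ⟨s, rfl⟩ := A.mk_surjective hr z
  exact congr($this s)

theorem A.induction {P : A hr → Prop} (hc : ∀ c : k, P (algebraMap k _ c))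
    (ha : P (A.a hr)) (hb : P (A.b hr)) (hx : P (A.x hr)) (hy : P (A.y hr))
    (hmul : ∀ s t, P s → P t → P (s * t)) (hadd : ∀ s t, P s → P t → P (s + t)) (z : A hr) :
    P z := by
  obtain ⟨s, rfl⟩ := A.mk_surjective hr z
  induction s using FreeAlgebra.induction with
  | grade0 c => simpa using hc c
  | grade1 i => cases i <;> assumption
  | mul s t hs ht => simpa using hmul _ _ hs ht
  | add s t hs ht => simpa using hadd _ _ hs ht

end Algebra

/-! ### Consequences of the relations -/

section Relations

variable {k : Type u} [Field k] {r : k} {T : Type*} [Ring T] [Algebra k T]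
  {a b x y : T}

theorem root_eq (hr : IsPrimitiveRoot r 3) : r ^ 2 + r + 1 = 0 := by
  have h3 : r ^ 3 = 1 := hr.pow_eq_one
  have h1 : r ≠ 1 := hr.ne_one (by norm_num)
  have : (r - 1) * (r ^ 2 + r + 1) = 0 := by linear_combination h3
  exact (mul_eq_zero.mp this).resolve_left (sub_ne_zero.mpr h1)

theorem three_ne (hr : IsPrimitiveRoot r 3) : (3 : k) ≠ 0 := by
  intro h
  have h1 : r ≠ 1 := hr.ne_one (by norm_num)
  have : (r - 1) ^ 2 = 0 := by linear_combination root_eq hr - r * h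
  exact h1 (sub_eq_zero.mp (pow_eq_zero_iff (by norm_num) |>.mp this))


namespace Satisfies


theorem lin1 (h : Satisfies r a b x y) : x * a ^ 2 + a * x * a + a ^ 2 * x = 1 - a ^ 2 := by
  have e := h.aaa
  have e1 := h.ax1
  linear_combination (norm := noncomm_ring) a ^ 2 * e1 - e * (x * a ^ 2) - e * (a * x * a) + e

theorem lin2 (h : Satisfies r a b x y) : a * x + x * a + a ^ 2 * x * a ^ 2 = a ^ 2 - a := by
  have e := h.aaa
  have e1 := h.ax1
  linear_combination (norm := noncomm_ring) a ^ 2 * e1 * a ^ 2 - e * (x * a ^ 4) - x * a * e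
    - a * e * (x * a ^ 3) - a * x * e + a ^ 2 * e - a * e

theorem quad (h : Satisfies r a b x y) : x ^ 2 * a + x * a * x + a * x ^ 2 = -(x * a + a * x) := by
  have e := h.aaa
  have e1 := h.ax2
  linear_combination (norm := noncomm_ring) e1 * a - a * x ^ 2 * e - x * a * x * e - a * x * e

theorem elemF_a (h : Satisfies r a b x y) (hr : IsPrimitiveRoot r 3) :
    elemF r a x * a = r • (a * elemF r a x) := by
  have e := h.aaa
  have hroot := root_eq hr
  have h3 := three_ne hr
  have e1 : x * (a * a) = 1 - a * a - a * (x * a) - a * (a * x) := by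
    linear_combination (norm := noncomm_ring) h.lin1
  have e3 : a * (a * a) = 1 := by linear_combination (norm := noncomm_ring) e
  simp only [elemF, add_mul, mul_add, smul_mul_assoc, mul_smul_comm, sub_mul, mul_sub, pow_two,
    mul_assoc, e1, e3, smul_add, smul_sub, smul_smul]
  match_scalars
  all_goals field_simp
  all_goals grind

theorem cube_add (hroot : r ^ 2 + r + 1 = 0) (P Q : T) (hP : P * (P * P) = 0)
    (hQ : Q * (Q * Q) = 0) (hPQ : P * Q = r • (Q * P)) : (P + Q) ^ 3 = 0 := by
  have e1 : P * (Q * P) = r • (Q * (P * P)) := by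
    rw [← mul_assoc, hPQ, smul_mul_assoc, mul_assoc]
  have e2 : P * (P * Q) = (r * r) • (Q * (P * P)) := by
    rw [hPQ, mul_smul_comm, e1, smul_smul]
  have e3 : Q * (P * Q) = r • (Q * (Q * P)) := by
    rw [hPQ, mul_smul_comm]
  have e4 : P * (Q * Q) = (r * r) • (Q * (Q * P)) := by
    rw [← mul_assoc, hPQ, smul_mul_assoc, mul_assoc, e3, smul_smul]
  have : (P + Q) ^ 3 = P * (P * P) + P * (P * Q) + P * (Q * P) + P * (Q * Q)
      + Q * (P * P) + Q * (P * Q) + Q * (Q * P) + Q * (Q * Q) := by noncomm_ring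
  rw [this, e1, e2, e3, e4, hP, hQ]
  match_scalars
  · linear_combination hroot
  · linear_combination hroot

theorem tensor {hr : IsPrimitiveRoot r 3} : Satisfies (T := A hr ⊗[k] A hr) r
    (A.a hr ⊗ₜ A.a hr) (A.b hr ⊗ₜ A.b hr) (1 ⊗ₜ A.x hr + A.x hr ⊗ₜ A.a hr)
    (1 ⊗ₜ A.y hr + A.y hr ⊗ₜ A.b hr) := by
  have h := A.satisfies hr
  set a := A.a hr
  set b := A.b hr
  set x := A.x hr
  set y := A.y hr
  have e3 : a * (a * a) = 1 := by linear_combination (norm := noncomm_ring) h.aaa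
  have eb : b * b = 1 := by linear_combination (norm := noncomm_ring) h.bb
  constructor
  · simp [h.ba]
  · simp [mul_add, add_mul, h.ya, h.ba]
  · simp [mul_add, add_mul, h.bx, h.ba]
  · simp [mul_add, add_mul, h.bx, h.ba, h.yx, h.ya]
    abel
  · simp [mul_add, add_mul, h.byy, TensorProduct.tmul_neg, TensorProduct.neg_tmul]
    abel
  · trans (1 : A hr) ⊗ₜ[k] (x + a * x * a ^ 2 + a ^ 2 * x * a - a + 1)
      + (x + a * x * a ^ 2 + a ^ 2 * x * a - a + 1) ⊗ₜ[k] a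
    · simp [mul_add, add_mul, TensorProduct.tmul_add, TensorProduct.add_tmul,
        TensorProduct.tmul_sub, TensorProduct.sub_tmul, pow_succ, mul_assoc, e3,
        Algebra.TensorProduct.one_def]
      abel
    · simp [h.ax1]
  · trans (1 : A hr) ⊗ₜ[k] (x ^ 2 + a * x ^ 2 * a ^ 2 + x * a * x * a ^ 2 + x + a * x * a ^ 2)
      + (x ^ 2 + a * x ^ 2 * a ^ 2 + x * a * x * a ^ 2 + x + a * x * a ^ 2) ⊗ₜ[k] (a ^ 2)
      + (x + a * x * a ^ 2) ⊗ₜ[k] (a * x + x * a + a ^ 2 * x * a ^ 2 - (a ^ 2 - a))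
    · simp [mul_add, add_mul, TensorProduct.tmul_add, TensorProduct.add_tmul,
        TensorProduct.tmul_sub, pow_succ, mul_assoc, e3]
      abel
    · rw [h.ax2, h.lin2]
      simp
  · rw [← sub_eq_zero]
    trans (1 : A hr) ⊗ₜ[k] (y ^ 2 - (x ^ 2 + x ^ 3)) + (y ^ 2 - (x ^ 2 + x ^ 3)) ⊗ₜ[k] (1 : A hr)
      - x ⊗ₜ[k] (x ^ 2 * a + x * a * x + a * x ^ 2 + (x * a + a * x))
      - (x ^ 2) ⊗ₜ[k] (x * a ^ 2 + a * x * a + a ^ 2 * x - (1 - a ^ 2))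
      + y ⊗ₜ[k] (b * y + y * b)
    · simp [mul_add, add_mul, TensorProduct.tmul_add, TensorProduct.add_tmul,
        TensorProduct.tmul_sub, TensorProduct.sub_tmul, pow_succ, mul_assoc, e3, eb]
      abel
    · rw [h.cubic, h.quad, h.lin1, h.byy]
      simp
  · simp [pow_two, eb, Algebra.TensorProduct.one_def]
  · simp [pow_succ, mul_assoc, e3, Algebra.TensorProduct.one_def]
  · have hF : elemF r (a ⊗ₜ[k] a) ((1 : A hr) ⊗ₜ[k] x + x ⊗ₜ[k] a) =
        a ⊗ₜ[k] elemF r a x + elemF r a x ⊗ₜ[k] (a * a) := by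
      simp only [elemF, mul_add, add_mul, TensorProduct.tmul_add, TensorProduct.add_tmul,
        TensorProduct.tmul_sub, TensorProduct.sub_tmul, TensorProduct.tmul_smul, smul_add,
        ← TensorProduct.smul_tmul', pow_two, one_mul, mul_one, smul_sub,
        Algebra.TensorProduct.tmul_mul_tmul]
      abel
    rw [hF]
    have hc := h.elemF_a hr
    have hF3 : elemF r a x * (elemF r a x * elemF r a x) = 0 := by
      linear_combination (norm := noncomm_ring) h.FFF
    generalize elemF r a x = F at hc hF3
    have hroot := root_eq hr
    have hFaa : F * (a * a) = (r * r) • (a * (a * F)) := by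
      rw [← mul_assoc, hc, smul_mul_assoc, mul_assoc, hc, mul_smul_comm, smul_smul]
    set P := a ⊗ₜ[k] F
    set Q := F ⊗ₜ[k] (a * a)
    have hP : P * (P * P) = 0 := by simp [P, hF3]
    have hQ : Q * (Q * Q) = 0 := by simp [Q, hF3]
    have hPQ : P * Q = r • (Q * P) := by
      simp only [P, Q, Algebra.TensorProduct.tmul_mul_tmul, hc, hFaa, mul_assoc,
        TensorProduct.tmul_smul, TensorProduct.smul_tmul', smul_smul]
    exact cube_add hroot P Q hP hQ hPQ

end Satisfies

end Relations
/-! ### The Hopf algebra structure -/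

section Hopf

variable {k : Type u} [Field k] {r : k} (hr : IsPrimitiveRoot r 3)

/-- The comultiplication: `a`, `b` are group-like, `Δ(x) = 1 ⊗ x + x ⊗ a` and
`Δ(y) = 1 ⊗ y + y ⊗ b`. -/
noncomputable def A.comul : A hr →ₐ[k] A hr ⊗[k] A hr :=
  A.lift hr (A.a hr ⊗ₜ A.a hr) (A.b hr ⊗ₜ A.b hr) (1 ⊗ₜ A.x hr + A.x hr ⊗ₜ A.a hr)
    (1 ⊗ₜ A.y hr + A.y hr ⊗ₜ A.b hr) Satisfies.tensor

/-- The counit: `ε(a) = ε(b) = 1` and `ε(x) = ε(y) = 0`. -/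
noncomputable def A.counit : A hr →ₐ[k] k :=
  A.lift hr 1 1 0 0 (by constructor <;> simp [elemF])

/-- The antipode as an algebra map to the opposite algebra: `S(a) = a²`, `S(b) = b`,
`S(x) = -xa²`, `S(y) = -yb`. -/
noncomputable def A.antipodeOp : A hr →ₐ[k] (A hr)ᵐᵒᵖ :=
  A.lift hr (.op (A.a hr ^ 2)) (.op (A.b hr)) (.op (-(A.x hr * A.a hr ^ 2)))
    (.op (-(A.y hr * A.b hr))) (by
      have h := A.satisfies hr
      set a := A.a hr
      set b := A.b hr
      set x := A.x hr
      set y := A.y hr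
      have e := h.aaa
      have e' : a * (a * a) = 1 := by linear_combination (norm := noncomm_ring) h.aaa
      have e'' : ∀ z, a * (a * (a * z)) = z := by
        intro z
        linear_combination (norm := noncomm_ring) h.aaa * z
      have ee : b * b = 1 := by linear_combination (norm := noncomm_ring) h.bb
      constructor <;> apply MulOpposite.unop_injective
      · change a ^ 2 * b = b * a ^ 2
        rw [pow_two, mul_assoc, ← h.ba, ← mul_assoc, ← h.ba, mul_assoc]
      · change a ^ 2 * (-(y * b)) = -(y * b) * a ^ 2
        have h1 : y * b * a = a * (y * b) := by
          rw [mul_assoc, h.ba, ← mul_assoc, h.ya, mul_assoc]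
        rw [mul_neg, neg_mul, neg_inj]
        calc a ^ 2 * (y * b) = a * (a * (y * b)) := by noncomm_ring
          _ = y * b * a ^ 2 := by rw [← h1, ← mul_assoc, ← h1, pow_two, mul_assoc]
      · change -(x * a ^ 2) * b = b * -(x * a ^ 2)
        have h1 : b * a ^ 2 = a ^ 2 * b := by
          rw [pow_two, ← mul_assoc, h.ba, mul_assoc, h.ba, mul_assoc]
        rw [mul_neg, ← mul_assoc, h.bx, mul_assoc, h1, neg_mul, mul_assoc]
      · change -(x * a ^ 2) * -(y * b) = -(y * b) * -(x * a ^ 2)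
        have h1 : b * a ^ 2 = a ^ 2 * b := by
          rw [pow_two, ← mul_assoc, h.ba, mul_assoc, h.ba, mul_assoc]
        have h2 : a ^ 2 * y = y * a ^ 2 := by
          rw [pow_two, mul_assoc, ← h.ya, ← mul_assoc, ← h.ya, mul_assoc]
        rw [neg_mul_neg, neg_mul_neg]
        calc x * a ^ 2 * (y * b) = x * (a ^ 2 * y) * b := by noncomm_ring
          _ = x * y * (a ^ 2 * b) := by rw [h2]; noncomm_ring
          _ = y * (x * b) * a ^ 2 := by rw [← h1, ← h.yx]; noncomm_ring
          _ = y * b * (x * a ^ 2) := by rw [← h.bx]; noncomm_ring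
      · change -(y * b) * b = -(b * -(y * b))
        rw [mul_neg, ← mul_assoc, h.byy, neg_mul, neg_neg]
      · change -(x * a ^ 2) + (a ^ 2) ^ 2 * (-(x * a ^ 2) * a ^ 2)
          + a ^ 2 * (-(x * a ^ 2) * (a ^ 2) ^ 2) - a ^ 2 + 1 = 0
        linear_combination (norm := noncomm_ring) -h.lin1 - e * (a * x * a ^ 4) - a * x * a * e
          - a ^ 2 * x * a ^ 3 * e - a ^ 2 * x * e
      · change (-(x * a ^ 2)) ^ 2 + (a ^ 2) ^ 2 * ((-(x * a ^ 2)) ^ 2 * a ^ 2)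
          + (a ^ 2) ^ 2 * (-(x * a ^ 2) * (a ^ 2 * -(x * a ^ 2))) + -(x * a ^ 2)
          + (a ^ 2) ^ 2 * (-(x * a ^ 2) * a ^ 2) = 0
        linear_combination (norm := noncomm_ring) h.lin1 * x * a ^ 2 + a * h.lin1 * x * a
          - a ^ 2 * h.quad * a + a * e * x * a ^ 2 * x * a ^ 4 + a * x * a ^ 2 * x * a * e
          + a * e * x * a ^ 4 * x * a ^ 2 + a * x * a * e * x * a ^ 2 - a * e * x * a ^ 4
          - a * x * a * e
      · change (-(y * b)) ^ 2 = (-(x * a ^ 2)) ^ 2 + (-(x * a ^ 2)) ^ 3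
        linear_combination (norm := noncomm_ring) y * h.byy * b - y ^ 2 * h.bb - h.cubic
          - x * a ^ 2 * h.quad + x * e * x ^ 2 + x * e * x + x * a ^ 2 * x * a * h.ax1
          - x * a ^ 2 * x * e * x * a
      · change b ^ 2 = 1
        exact h.bb
      · change (a ^ 2) ^ 3 = 1
        rw [← pow_mul, mul_comm, pow_mul, e, one_pow]
      · have h1 : elemF r (MulOpposite.op (a ^ 2)) (MulOpposite.op (-(x * a ^ 2))) =
            MulOpposite.op (-(a ^ 2 * elemF r a x * a)) := by
          apply MulOpposite.unop_injective
          simp only [elemF, MulOpposite.unop_add, MulOpposite.unop_sub, MulOpposite.unop_mul,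
            MulOpposite.unop_smul, MulOpposite.unop_op, mul_add, add_mul,
            mul_sub, sub_mul, mul_smul_comm, smul_mul_assoc, pow_succ, pow_zero, one_mul,
            mul_assoc, e', e'', mul_one, mul_neg, neg_mul]
          module
        have h2 : (-(a ^ 2 * elemF r a x * a)) ^ 3 = 0 := by
          linear_combination (norm := noncomm_ring) -(a ^ 2 * h.FFF * a)
            - a ^ 2 * elemF r a x * e * elemF r a x * a ^ 3 * elemF r a x * a
            - a ^ 2 * elemF r a x ^ 2 * e * elemF r a x * a
        rw [h1, ← MulOpposite.op_pow, h2]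
        rfl)

noncomputable instance : Bialgebra k (A hr) :=
  Bialgebra.ofAlgHom (A.comul hr) (A.counit hr)
    (by
      apply A.hom_ext <;>
        simp [A.comul, TensorProduct.tmul_add, TensorProduct.add_tmul,
          Algebra.TensorProduct.one_def, add_assoc])
    (by apply A.hom_ext <;> simp [A.comul, A.counit])
    (by apply A.hom_ext <;> simp [A.comul, A.counit])

section Antipode

theorem A.antipode_left_aux (t : A hr ⊗[k] A hr) (c : k)
    (ht : LinearMap.mul' k (A hr) (((MulOpposite.opLinearEquiv k).symm.toLinearMap ∘ₗ
      (A.antipodeOp hr).toLinearMap).rTensor (A hr) t) = algebraMap k _ c) (u : A hr ⊗[k] A hr) :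
    LinearMap.mul' k (A hr) (((MulOpposite.opLinearEquiv k).symm.toLinearMap ∘ₗ
      (A.antipodeOp hr).toLinearMap).rTensor (A hr) (t * u)) =
    algebraMap k _ c * LinearMap.mul' k (A hr) (((MulOpposite.opLinearEquiv k).symm.toLinearMap ∘ₗ
      (A.antipodeOp hr).toLinearMap).rTensor (A hr) u) := by
  set m := LinearMap.mul' k (A hr) ∘ₗ ((MulOpposite.opLinearEquiv k).symm.toLinearMap ∘ₗ
      (A.antipodeOp hr).toLinearMap).rTensor (A hr) with hm
  change m t = _ at ht
  change m (t * u) = _ * m u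
  induction u using TensorProduct.induction_on with
  | zero => simp
  | add u v hu hv => rw [mul_add, map_add, hu, hv, map_add, mul_add]
  | tmul p q =>
    have key : ∀ t, m (t * p ⊗ₜ q) = (A.antipodeOp hr p).unop * m t * q := by
      intro t
      induction t using TensorProduct.induction_on with
      | zero => simp
      | add u v hu hv => rw [add_mul, map_add, hu, hv, map_add, mul_add, add_mul]
      | tmul v w => simp [hm, mul_assoc]
    rw [key, ht, ← Algebra.commutes, mul_assoc]
    simp [hm]

theorem A.antipode_right_aux (t : A hr ⊗[k] A hr) (c : k)
    (ht : LinearMap.mul' k (A hr) (((MulOpposite.opLinearEquiv k).symm.toLinearMap ∘ₗ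
      (A.antipodeOp hr).toLinearMap).lTensor (A hr) t) = algebraMap k _ c) (u : A hr ⊗[k] A hr) :
    LinearMap.mul' k (A hr) (((MulOpposite.opLinearEquiv k).symm.toLinearMap ∘ₗ
      (A.antipodeOp hr).toLinearMap).lTensor (A hr) (u * t)) =
    LinearMap.mul' k (A hr) (((MulOpposite.opLinearEquiv k).symm.toLinearMap ∘ₗ
      (A.antipodeOp hr).toLinearMap).lTensor (A hr) u) * algebraMap k _ c := by
  set m := LinearMap.mul' k (A hr) ∘ₗ ((MulOpposite.opLinearEquiv k).symm.toLinearMap ∘ₗ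
      (A.antipodeOp hr).toLinearMap).lTensor (A hr) with hm
  change m t = _ at ht
  change m (u * t) = m u * _
  induction u using TensorProduct.induction_on with
  | zero => simp
  | add u v hu hv => rw [add_mul, map_add, hu, hv, map_add, add_mul]
  | tmul p q =>
    have key : ∀ t, m (p ⊗ₜ q * t) = p * m t * (A.antipodeOp hr q).unop := by
      intro t
      induction t using TensorProduct.induction_on with
      | zero => simp
      | add u v hu hv => rw [mul_add, map_add, hu, hv, map_add, mul_add, add_mul]
      | tmul v w => simp [hm, mul_assoc]
    rw [key, ht, mul_assoc, Algebra.commutes, ← mul_assoc]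
    simp [hm]

noncomputable instance : HopfAlgebra k (A hr) where
  antipode := (MulOpposite.opLinearEquiv k).symm.toLinearMap ∘ₗ (A.antipodeOp hr).toLinearMap
  mul_antipode_rTensor_comul := by
    have h := A.satisfies hr
    have e : A.a hr * A.a hr ^ 2 = 1 := by rw [← pow_succ', h.aaa]
    have e' : A.a hr ^ 2 * A.a hr = 1 := by rw [← pow_succ, h.aaa]
    have ee : A.b hr * A.b hr = 1 := by rw [← pow_two, h.bb]
    ext z
    change LinearMap.mul' k (A hr) (LinearMap.rTensor (A hr) _ (A.comul hr z)) =
      algebraMap k _ (A.counit hr z)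
    induction z using A.induction hr with
    | hc c => simp
    | ha => simp [A.comul, A.counit, A.antipodeOp, e']
    | hb => simp [A.comul, A.counit, A.antipodeOp, ee]
    | hx => simp [A.comul, A.counit, A.antipodeOp, mul_assoc, e']
    | hy => simp [A.comul, A.counit, A.antipodeOp, mul_assoc, ee]
    | hmul s t hs ht => rw [map_mul, A.antipode_left_aux hr _ _ hs, ht, map_mul, map_mul]
    | hadd s t hs ht => rw [map_add, map_add, map_add, hs, ht, map_add, map_add]
  mul_antipode_lTensor_comul := by
    have h := A.satisfies hr
    have e : A.a hr * A.a hr ^ 2 = 1 := by rw [← pow_succ', h.aaa]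
    have ee : A.b hr * A.b hr = 1 := by rw [← pow_two, h.bb]
    ext z
    change LinearMap.mul' k (A hr) (LinearMap.lTensor (A hr) _ (A.comul hr z)) =
      algebraMap k _ (A.counit hr z)
    induction z using A.induction hr with
    | hc c => simp
    | ha => simp [A.comul, A.counit, A.antipodeOp, e]
    | hb => simp [A.comul, A.counit, A.antipodeOp, ee]
    | hx => simp [A.comul, A.counit, A.antipodeOp]
    | hy => simp [A.comul, A.counit, A.antipodeOp]
    | hmul s t hs ht => rw [map_mul, A.antipode_right_aux hr _ _ ht, hs, map_mul, map_mul]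
    | hadd s t hs ht => rw [map_add, map_add, map_add, hs, ht, map_add, map_add]

end Antipode

/-- The element `F` of `A`. -/
noncomputable def A.F : A hr := elemF r (A.a hr) (A.x hr)

/-- The element `E` of `A`. -/
noncomputable def A.E : A hr := elemE r (A.a hr) (A.x hr)

/-- The element `K = a²` of `A`. -/
noncomputable def A.K : A hr := A.a hr ^ 2

/-- The Casimir element `Ω = EF + (r²K + rK²)/(r - r²)²`. -/
noncomputable def A.casimir : A hr :=
  A.E hr * A.F hr + ((r - r ^ 2) ^ 2)⁻¹ • (r ^ 2 • A.K hr + r • A.K hr ^ 2)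

end Hopf

/-! ### Ring-theoretic notions -/

/-- The Gelfand–Kirillov dimension of a `k`-algebra `R`: the supremum, over the
finite-dimensional subspaces `V` of `R`, of `limsup_n log (dim (V⁰ + V¹ + ⋯ + Vⁿ)) / log n`. -/
noncomputable def gkDim (k : Type*) [Field k] (R : Type*) [Ring R] [Algebra k R] : EReal :=
  ⨆ V : {V : Submodule k R // V.FG},
    Filter.limsup (fun n : ℕ =>
      ((Real.log (Module.finrank k (⨆ i : Fin (n + 1), V.1 ^ (i : ℕ) : Submodule k R))
        / Real.log n : ℝ) : EReal)) Filter.atTop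

/-- Regularity of a (noncommutative) ring: its left global dimension is finite. The right version is
this notion for the opposite ring. -/
def HasFiniteGlobalDimension (R : Type u) [Ring R] : Prop :=
  ∃ n : ℕ, ∀ M : ModuleCat.{u} R, HasProjectiveDimensionLE M n

/-- A ring is semiprime if it has no nonzero nilpotent two-sided ideal. -/
def IsSemiprimeRing (R : Type*) [Ring R] : Prop :=
  ∀ I : Ideal R, I.IsTwoSided → IsNilpotent I → I = ⊥

/-- The one-dimensional module given by a ring homomorphism `ε : R → k`. -/
noncomputable def charModule {R k : Type u} [Ring R] [Field k] (ε : R →+* k) : ModuleCat.{u} R :=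
  (ModuleCat.restrictScalars ε).obj (ModuleCat.of k k)

section Trivial

variable {k : Type u} [Field k] {r : k} (hr : IsPrimitiveRoot r 3)

/-- The trivial left `A`-module: the ground field, on which `A` acts via the counit. -/
noncomputable def trivialModule : ModuleCat.{u} (A hr) :=
  charModule (Bialgebra.counitAlgHom k (A hr)).toRingHom

/-- The trivial right `A`-module. -/
noncomputable def trivialRightModule : ModuleCat.{u} (A hr)ᵐᵒᵖ :=
  charModule ((Bialgebra.counitAlgHom k (A hr)).toRingHom.fromOpposite fun _ _ => Commute.all _ _)

end Trivial

/-- The coordinate ring `k[s, t] / (t² - s² - s³)` of the nodal cubic, with `s`, `t` the variables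
number `0`, `1`. -/
abbrev CubicRing (k : Type u) [Field k] : Type u :=
  MvPolynomial (Fin 2) k ⧸ Ideal.span
    {(MvPolynomial.X 1 ^ 2 - MvPolynomial.X 0 ^ 2 - MvPolynomial.X 0 ^ 3 : MvPolynomial (Fin 2) k)}

/-- The quotient map `k[s, t] → k[s, t] / (t² - s² - s³)`. -/
noncomputable abbrev CubicRing.mk (k : Type u) [Field k] :
    MvPolynomial (Fin 2) k →ₐ[k] CubicRing k :=
  Ideal.Quotient.mkₐ k _

end NodalCubic

open NodalCubic

/-!
Conjugation by `a` has order three, so `x` splits into eigenvectors: `x = (a - 1)/3 + P + Q`, where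
`P a = r² a P` and `Q a = r a Q`. Up to scalars, `a P` is the element `E` and `a Q` is the element
`F`, and in terms of `P` and `Q` the relations become those of a quantum group of type `sl₂` at a
cube root of unity: a commutation relation between `P` and `Q`, the relation `Q³ = 0`, and
`P³ = x² + x³ = y²` (`Satisfies.eigen`, `EigenSatisfies.satisfies`).

Let `B = k[s, t]/(t² - s² - s³)`, mapped to `A` by `s ↦ x`, `t ↦ y`, and let `eₘ` be the idempotents
of `k[a]`. The elements `Qˡ eₘ bⁱ`, with `l, m < 3` and `i < 2`, span `A` as a left `B`-module,
because their span is stable under right multiplication by the generators. They are independent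
because right multiplication by the generators can be written as explicit operators on `B¹⁸` that
satisfy the relations of `A` (`coord_eigenSatisfies`), which gives a coordinate map inverse to the
expansion in these elements. Hence `A` is a free left `B`-module of rank 18 (`A.cubicBasis`), and
`B` embeds in `A`. The relations are invariant under reversal of words up to replacing `r` by `r²`
(`A.revEquiv`), so that the opposite algebra of `A` is free over `B` as well.

Freeness gives the ring-theoretic and homological assertions.
* `A` is Noetherian on both sides because `B` is.
* `A` is finitely generated as a left module over the polynomial ring `k[x]`, which it contains;
  this forces the Gelfand–Kirillov dimension to be one (`gkDim_le_one`, `one_le_gkDim`).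
* The maximal ideal `(s, t)` of the singular point of the cubic is isomorphic to its own module of
  syzygies and is not projective, so that the residue field has infinite projective dimension over
  `B` (`CubicRing.projectiveDimension_residueField`). The trivial modules of `A` restrict to this
  residue field, and restriction along a projective extension does not raise projective dimensions
  (`hasProjectiveDimensionLT_restrictScalars`).

In eigenvector coordinates the Casimir element is `Ω = 3r a²QP - (r a² + r² a)/3`. A normal form
computation shows that it is central and that `(Ω - 1/3)² (Ω + 2/3) = 0`
(`EigenCore.casimir_cube`). The coordinates of `1`, `Ω - 1/3` and `(Ω - 1/3)²` at the elements
`Qˡ e₀` show that these three elements are linearly independent (`A.casimir_independent`). So this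
polynomial is the minimal one, and `(Ω - 1/3)(Ω + 2/3)` is a nonzero central element of square zero,
which generates a nonzero nilpotent two-sided ideal.
-/

namespace NodalCubic

/-! ### The relations in eigenvector coordinates -/

/-- The relations between `a` and `x` in terms of the components of `x` under conjugation by `a`:
when `x = (a - 1) / 3 + P + Q`, where `P` and `Q` are eigenvectors with eigenvalues `r` and `r²`,
the relations say that `a`, `P` and `Q` generate a quantum group of type `sl₂` at a cube root of
unity, in which `Q³ = 0`. -/
structure EigenCore {k : Type*} [Field k] {T : Type*} [Ring T] [Algebra k T] (r : k)
    (a P Q : T) : Prop where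
  aaa : a ^ 3 = 1
  Pa : P * a = r ^ 2 • (a * P)
  Qa : Q * a = r • (a * Q)
  PQ : P * Q = r ^ 2 • (Q * P) + (1 / (3 * (1 - r))) • (1 - a ^ 2)
  QQQ : Q ^ 3 = 0

/-- The relations of `A`, with the generator `x` replaced by its two eigenvector components. -/
structure EigenSatisfies {k : Type*} [Field k] {T : Type*} [Ring T] [Algebra k T] (r : k)
    (a b P Q y : T) : Prop extends EigenCore r a P Q where
  ba : b * a = a * b
  bP : b * P = P * b
  bQ : b * Q = Q * b
  ya : y * a = a * y
  yP : y * P = P * y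
  yQ : y * Q = Q * y
  byy : b * y = -(y * b)
  bb : b ^ 2 = 1
  yy : y ^ 2 = P ^ 3

variable {k : Type u} [Field k] {r : k} {T : Type*} [Ring T] [Algebra k T]

theorem r_pow_three (hr : IsPrimitiveRoot r 3) : r ^ 3 = 1 := hr.pow_eq_one

theorem one_sub_ne (hr : IsPrimitiveRoot r 3) : 1 - r ≠ 0 :=
  sub_ne_zero.mpr (hr.ne_one (by norm_num)).symm

/-- Rewriting rules that bring words in `a`, `Q`, `P` to the normal form `aⁱ Qʲ Pᵏ`. -/
theorem EigenCore.assoc {a P Q : T} (h : EigenCore r a P Q) :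
    (a * (a * a) = 1 ∧ ∀ z, a * (a * (a * z)) = z) ∧
    (P * a = r ^ 2 • (a * P) ∧ ∀ z, P * (a * z) = r ^ 2 • (a * (P * z))) ∧
    (Q * a = r • (a * Q) ∧ ∀ z, Q * (a * z) = r • (a * (Q * z))) ∧
    (P * Q = r ^ 2 • (Q * P) + (1 / (3 * (1 - r))) • (1 - a * a) ∧
      ∀ z, P * (Q * z) = r ^ 2 • (Q * (P * z)) + (1 / (3 * (1 - r))) • (z - a * (a * z))) ∧
    (Q * (Q * Q) = 0 ∧ ∀ z, Q * (Q * (Q * z)) = 0) := by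
  have e1 : a * (a * a) = 1 := by rw [← h.aaa, pow_succ, pow_two, mul_assoc]
  have e2 : Q * (Q * Q) = 0 := by rw [← h.QQQ, pow_succ, pow_two, mul_assoc]
  have e3 := h.PQ
  rw [pow_two a] at e3
  refine ⟨⟨e1, fun z => ?_⟩, ⟨h.Pa, fun z => ?_⟩, ⟨h.Qa, fun z => ?_⟩, ⟨e3, fun z => ?_⟩,
    ⟨e2, fun z => ?_⟩⟩
  · rw [← mul_assoc a a z, ← mul_assoc, e1, one_mul]
  · rw [← mul_assoc, h.Pa, smul_mul_assoc, mul_assoc]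
  · rw [← mul_assoc, h.Qa, smul_mul_assoc, mul_assoc]
  · rw [← mul_assoc, e3]
    simp only [add_mul, smul_mul_assoc, sub_mul, one_mul, mul_assoc]
  · rw [← mul_assoc Q Q z, ← mul_assoc, e2, zero_mul]

theorem EigenCore.elemF_eq {a P Q : T} (hr : IsPrimitiveRoot r 3)
    (h : EigenCore r a P Q) :
    elemF r a ((3 : k)⁻¹ • (a - 1) + P + Q) = (r - r ^ 2) • (a * Q) := by
  have h0 := root_eq hr
  obtain ⟨-, ⟨p1, -⟩, ⟨q1, -⟩, -, -⟩ := h.assoc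
  simp only [elemF, pow_succ a, pow_zero, one_mul, mul_one, mul_add, add_mul, mul_sub, sub_mul,
    smul_mul_assoc, mul_smul_comm, p1, q1, smul_add, smul_sub, smul_smul]
  match_scalars <;> field_simp <;> grind

theorem EigenCore.elemE_eq {a P Q : T} (h : EigenCore r a P Q) :
    elemE r a ((3 : k)⁻¹ • (a - 1) + P + Q) = (r ^ 2 - r) • (a * P) := by
  obtain ⟨-, ⟨p1, -⟩, ⟨q1, -⟩, -, -⟩ := h.assoc
  simp only [elemE, pow_succ a, pow_zero, one_mul, mul_one, mul_add, add_mul, mul_sub, sub_mul,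
    smul_mul_assoc, mul_smul_comm, p1, q1, smul_add, smul_sub, smul_smul]
  match_scalars <;> field_simp <;> grind

/-- The cubic `x² + x³` is `P³`. -/
theorem EigenCore.sq_add_cube {a P Q : T} (hr : IsPrimitiveRoot r 3)
    (h : EigenCore r a P Q) :
    ((3 : k)⁻¹ • (a - 1) + P + Q) ^ 2 + ((3 : k)⁻¹ • (a - 1) + P + Q) ^ 3 = P ^ 3 := by
  have h0 := root_eq hr
  have h3 := three_ne hr
  obtain ⟨⟨a1, -⟩, ⟨p1, p2⟩, ⟨q1, q2⟩, ⟨pq1, pq2⟩, ⟨qq1, -⟩⟩ := h.assoc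
  simp only [pow_succ (_ : T), pow_zero (_ : T), one_mul, mul_one, mul_add, add_mul, mul_sub,
    sub_mul, smul_mul_assoc, mul_smul_comm, mul_assoc, a1, p1, p2, q1, q2, pq1, pq2, qq1, smul_add,
    smul_sub, smul_smul]
  match_scalars <;> field_simp <;> grind

theorem EigenSatisfies.satisfies {a b P Q y : T} (hr : IsPrimitiveRoot r 3)
    (h : EigenSatisfies r a b P Q y) :
    Satisfies r a b ((3 : k)⁻¹ • (a - 1) + P + Q) y := by
  have h0 := root_eq hr
  have h3 := three_ne hr
  have hs := h.sq_add_cube hr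
  have hF := h.elemF_eq hr
  obtain ⟨⟨a1, a2⟩, ⟨p1, p2⟩, ⟨q1, q2⟩, ⟨pq1, -⟩, ⟨qq1, -⟩⟩ := h.assoc
  constructor
  · exact h.ba
  · exact h.ya
  · simp [mul_add, add_mul, mul_sub, sub_mul, h.ba, h.bP, h.bQ]
  · simp [mul_add, add_mul, mul_sub, sub_mul, h.ya, h.yP, h.yQ]
  · exact h.byy
  · simp only [pow_succ (_ : T), pow_zero (_ : T), one_mul, mul_one, mul_add, add_mul, mul_sub,
      sub_mul, smul_mul_assoc, mul_smul_comm, mul_assoc, a1, a2, p1, p2, q1, q2, smul_sub,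
      smul_smul]
    match_scalars <;> field_simp <;> grind
  · simp only [pow_succ (_ : T), pow_zero (_ : T), one_mul, mul_one, mul_add, add_mul, mul_sub,
      sub_mul, smul_mul_assoc, mul_smul_comm, mul_assoc, a1, a2, p1, p2, q1, q2, pq1, smul_add,
      smul_sub, smul_smul]
    match_scalars <;> field_simp <;> grind
  · rw [hs, h.yy]
  · exact h.bb
  · exact h.aaa
  · rw [hF, smul_pow]
    simp only [pow_succ (_ : T), pow_zero (_ : T), one_mul, mul_smul_comm, smul_mul_assoc,
      mul_assoc, a2, q2, qq1, smul_smul, smul_zero]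

theorem Satisfies.elemE_a {a b x y : T} (hr : IsPrimitiveRoot r 3) (h : Satisfies r a b x y) :
    elemE r a x * a = r ^ 2 • (a * elemE r a x) := by
  have h0 := root_eq hr
  have h3 := three_ne hr
  have e1 : x * (a * a) = 1 - a * a - a * (x * a) - a * (a * x) := by
    linear_combination (norm := noncomm_ring) h.lin1
  have e3 : a * (a * a) = 1 := by rw [← h.aaa, pow_succ, pow_two, mul_assoc]
  simp only [elemE, add_mul, mul_add, smul_mul_assoc, mul_smul_comm, sub_mul, mul_sub, pow_two a,
    mul_assoc, e1, e3, smul_add, smul_sub, smul_smul]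
  match_scalars <;> field_simp <;> grind

/-- The eigenvector decomposition of `x`. -/
theorem Satisfies.x_eq {a b x y : T} (hr : IsPrimitiveRoot r 3) (h : Satisfies r a b x y) :
    x = (3 : k)⁻¹ • (a - 1) + (r ^ 2 - r)⁻¹ • (a ^ 2 * elemE r a x)
      + (r - r ^ 2)⁻¹ • (a ^ 2 * elemF r a x) := by
  have h0 := root_eq hr
  have h3 := three_ne hr
  have e3 : ∀ z, a * (a * (a * z)) = z := fun z => by
    rw [← mul_assoc a a z, ← mul_assoc, ← pow_two, ← pow_succ', h.aaa, one_mul]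
  have e3' : a * (a * a) = 1 := by rw [← h.aaa, pow_succ, pow_two, mul_assoc]
  have h2 : r ^ 2 - r = -(r * (1 - r)) := by ring
  have h2' : r - r ^ 2 = r * (1 - r) := by ring
  simp only [elemE, elemF, h2, h2', mul_add (_ : T), mul_smul_comm, mul_sub (_ : T), pow_two a,
    mul_assoc, mul_one, e3, e3', smul_add, smul_sub, smul_smul]
  match_scalars <;> field_simp <;> grind

theorem Satisfies.eigen {a b x y : T} (hr : IsPrimitiveRoot r 3) (h : Satisfies r a b x y) :
    EigenSatisfies r a b ((r ^ 2 - r)⁻¹ • (a ^ 2 * elemE r a x))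
      ((r - r ^ 2)⁻¹ • (a ^ 2 * elemF r a x)) y := by
  have h0 := root_eq hr
  have h3 := three_ne hr
  have a1 : a * (a * a) = 1 := by rw [← h.aaa, pow_succ, pow_two, mul_assoc]
  have a2 : ∀ z, a * (a * (a * z)) = z := fun z => by
    rw [← mul_assoc a a z, ← mul_assoc, a1, one_mul]
  have hE := h.elemE_a hr
  have hF := h.elemF_a hr
  have hFFF : elemF r a x * (elemF r a x * elemF r a x) = 0 := by
    rw [← h.FFF, pow_succ, pow_two, mul_assoc]
  have hx := h.x_eq hr
  have comm : ∀ g : T, g * a = a * g → g * x = x * g →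
      g * elemE r a x = elemE r a x * g ∧ g * elemF r a x = elemF r a x * g := by
    intro g (ga : Commute g a) (gx : Commute g x)
    exact ⟨((gx.mul_right ga).sub_right ((ga.mul_right gx).smul_right _)).add_right
        ((ga.sub_right (ga.pow_right 2)).smul_right _),
      ((gx.mul_right ga).add_right ((ga.mul_right gx).smul_right _)).add_right
        ((ga.sub_right (ga.pow_right 2)).smul_right _)⟩
  obtain ⟨bE, bF⟩ := comm b h.ba h.bx
  obtain ⟨yE, yF⟩ := comm y h.ya h.yx
  set P := (r ^ 2 - r)⁻¹ • (a ^ 2 * elemE r a x) with hPdef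
  set Q := (r - r ^ 2)⁻¹ • (a ^ 2 * elemF r a x) with hQdef
  have ba : Commute b a := h.ba
  have ya : Commute y a := h.ya
  have p1 : P * a = r ^ 2 • (a * P) := by
    simp only [hPdef, smul_mul_assoc, mul_smul_comm, mul_assoc, hE, pow_two a]
    rw [smul_comm]
  have q1 : Q * a = r • (a * Q) := by
    simp only [hQdef, smul_mul_assoc, mul_smul_comm, mul_assoc, hF, pow_two a]
    rw [smul_comm]
  have p2 : ∀ z, P * (a * z) = r ^ 2 • (a * (P * z)) := fun z => by
    rw [← mul_assoc, p1, smul_mul_assoc, mul_assoc]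
  have q2 : ∀ z, Q * (a * z) = r • (a * (Q * z)) := fun z => by
    rw [← mul_assoc, q1, smul_mul_assoc, mul_assoc]
  have QQQ : Q ^ 3 = 0 := by
    have f2 : ∀ z, elemF r a x * (a * z) = r • (a * (elemF r a x * z)) := fun z => by
      rw [← mul_assoc, hF, smul_mul_assoc, mul_assoc]
    simp only [hQdef, pow_succ (_ : T), pow_zero, one_mul, mul_assoc, f2, mul_smul_comm,
      smul_mul_assoc, hFFF, mul_zero, smul_zero]
  have PQ : P * Q = r ^ 2 • (Q * P) + (1 / (3 * (1 - r))) • (1 - a ^ 2) := by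
    have hq := h.quad
    rw [hx] at hq
    have hq' := congrArg (fun z => a * (a * z)) hq
    simp only [pow_succ (_ : T), pow_zero (_ : T), one_mul, mul_one, mul_add, add_mul, mul_sub,
      sub_mul, smul_mul_assoc, mul_smul_comm, mul_neg, mul_assoc, a1, a2, p1, p2, q1, q2, smul_add,
      smul_sub, smul_smul] at hq'
    rw [pow_two a]
    linear_combination (norm := skip) (1 - r)⁻¹ • hq'
    match_scalars <;> field_simp <;> grind
  have core : EigenCore r a P Q := ⟨h.aaa, p1, q1, PQ, QQQ⟩
  refine ⟨core, h.ba, ((ba.pow_right 2).mul_right bE).smul_right _,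
    ((ba.pow_right 2).mul_right bF).smul_right _, h.ya,
    ((ya.pow_right 2).mul_right yE).smul_right _,
    ((ya.pow_right 2).mul_right yF).smul_right _, h.byy, h.bb, ?_⟩
  rw [← core.sq_add_cube hr, ← hx, h.cubic]


/-! ### Reversing the order of multiplication -/

section Reversal

open MulOpposite

variable {k : Type u} [Field k] {r : k} {T : Type*} [Ring T] [Algebra k T]

/-- The relations are invariant under reversing all words, up to exchanging the two primitive
third roots of unity: reversal turns `F` for the root `r` into a multiple of `F` for `r²`. -/
theorem Satisfies.opposite {a b x y : T} (hr : IsPrimitiveRoot r 3) (h : Satisfies r a b x y) :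
    Satisfies (r ^ 2) (op a) (op b) (op x) (op y) := by
  have h0 := root_eq hr
  have aaa : a * (a * a) = 1 := by rw [← h.aaa, pow_succ, pow_two, mul_assoc]
  have hF : elemF (r ^ 2) (op a) (op x) = -r • op (elemF r a x) := by
    apply unop_injective
    simp only [elemF, MulOpposite.unop_add, MulOpposite.unop_sub, MulOpposite.unop_mul,
      MulOpposite.unop_smul, MulOpposite.unop_op, pow_two]
    match_scalars <;> field_simp <;> grind
  constructor <;> apply unop_injective
  · exact h.ba.symm
  · exact h.ya.symm
  · exact h.bx.symm
  · exact h.yx.symm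
  · simpa using by rw [h.byy, neg_neg]
  · simp only [MulOpposite.unop_add, MulOpposite.unop_sub, MulOpposite.unop_mul,
      MulOpposite.unop_op, MulOpposite.unop_pow, MulOpposite.unop_one, MulOpposite.unop_zero]
    linear_combination (norm := noncomm_ring) h.ax1
  · simp only [MulOpposite.unop_add, MulOpposite.unop_mul, MulOpposite.unop_op,
      MulOpposite.unop_pow, MulOpposite.unop_zero]
    linear_combination (norm := noncomm_ring) a ^ 2 * h.quad - aaa * x ^ 2 - aaa * x
  · exact h.cubic
  · exact h.bb
  · exact h.aaa
  · rw [hF, smul_pow, ← op_pow, h.FFF, op_zero, smul_zero]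

/-- The other primitive third root of unity. -/
theorem sq_primitive (hr : IsPrimitiveRoot r 3) : IsPrimitiveRoot (r ^ 2) 3 :=
  hr.pow_of_coprime 2 (by norm_num)

/-- The opposite algebra of `A`, for the root `r`, is the algebra `A` for the root `r²`, by the
map that fixes the four generators. -/
noncomputable def A.revEquiv (hr : IsPrimitiveRoot r 3) : A (sq_primitive hr) ≃ₐ[k] (A hr)ᵐᵒᵖ :=
  AlgEquiv.ofAlgHom (A.lift _ _ _ _ _ ((A.satisfies hr).opposite hr))
    (AlgHom.opComm (A.lift hr _ _ _ _ (show Satisfies r _ _ _ _ from by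
      have h := (A.satisfies (sq_primitive hr)).opposite (sq_primitive hr)
      rwa [← pow_mul, show r ^ (2 * 2) = r ^ 3 * r by ring, r_pow_three hr, one_mul] at h)))
    (by
      apply AlgHom.op.symm.injective
      apply A.hom_ext <;> simp [AlgHom.opComm, AlgHom.op])
    (by apply A.hom_ext <;> simp [AlgHom.opComm])

end Reversal


/-! ### A representation on a free module of rank 18 -/

section Representation

open Matrix MulOpposite

variable {k : Type u} [Field k] {r : k} {B : Type*} [CommRing B] [Algebra k B]

/-- The character `m ↦ r ^ m` of `ℤ/3`. -/
def rootPow (r : k) (m : ZMod 3) : k := r ^ m.val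

theorem rootPow_add_one (hr : IsPrimitiveRoot r 3) (m : ZMod 3) :
    rootPow r (m + 1) = r * rootPow r m := by
  have h3 := r_pow_three hr
  revert m
  change ∀ m : Fin 3, _
  intro m
  fin_cases m
  · change r ^ 1 = r * r ^ 0; ring
  · change r ^ 2 = r * r ^ 1; ring
  · change r ^ 0 = r * r ^ 2; rw [← pow_succ', h3, pow_zero]

theorem rootPow_sub_one (hr : IsPrimitiveRoot r 3) (m : ZMod 3) :
    rootPow r (m - 1) = r ^ 2 * rootPow r m := by
  have h := rootPow_add_one hr (m - 1)
  rw [sub_add_cancel] at h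
  rw [h, ← mul_assoc, ← pow_succ, r_pow_three hr, one_mul]

theorem rootPow_pow_three (hr : IsPrimitiveRoot r 3) (m : ZMod 3) : rootPow r m ^ 3 = 1 := by
  rw [rootPow, ← pow_mul, mul_comm, pow_mul, r_pow_three hr, one_pow]

variable (B) in
/-- The coordinate space, of rank 18 over `B`, of the basis `Qˡ eₘ bⁱ` of `A` as a left module over
the coordinate ring `B` of the cubic; here `eₘ` is the idempotent with `a eₘ = rᵐ eₘ`. The entry at
`i`, `m`, `l` is the coefficient of `Qˡ eₘ bⁱ`. -/
abbrev Coord : Type _ := Fin 2 → ZMod 3 → Fin 3 → B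

/-- The operator on the coordinate space that acts on the index `l` by matrices `M m` and shifts
the index `m` by `d`. -/
def blockOp (M : ZMod 3 → Matrix (Fin 3) (Fin 3) B) (d : ZMod 3) : Module.End B (Coord B) where
  toFun v i m := M m *ᵥ v i (m + d)
  map_add' v w := by ext; simp [mulVec_add]
  map_smul' c v := by ext; simp [mulVec_smul]

@[simp] theorem blockOp_apply (M : ZMod 3 → Matrix (Fin 3) (Fin 3) B) (d : ZMod 3) (v : Coord B)
    (i : Fin 2) (m : ZMod 3) : blockOp M d v i m = M m *ᵥ v i (m + d) := rfl

theorem blockOp_mul (M N : ZMod 3 → Matrix (Fin 3) (Fin 3) B) (d e : ZMod 3) :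
    blockOp M d * blockOp N e = blockOp (fun m => M m * N (m + d)) (d + e) := by
  refine LinearMap.ext fun v => ?_
  funext i m
  simp [add_assoc]

theorem blockOp_add (M N : ZMod 3 → Matrix (Fin 3) (Fin 3) B) (d : ZMod 3) :
    blockOp M d + blockOp N d = blockOp (fun m => M m + N m) d := by
  refine LinearMap.ext fun v => ?_
  funext i m
  simp [add_mulVec]

theorem blockOp_smul (c : k) (M : ZMod 3 → Matrix (Fin 3) (Fin 3) B) (d : ZMod 3) :
    c • blockOp M d = blockOp (fun m => c • M m) d := by
  refine LinearMap.ext fun v => ?_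
  funext i m
  simp [smul_mulVec]

theorem blockOp_one : blockOp (fun _ => (1 : Matrix (Fin 3) (Fin 3) B)) 0 = 1 := by
  refine LinearMap.ext fun v => ?_
  funext i m
  simp

/-- Right multiplication by `a`. -/
def opA (B : Type*) [CommRing B] [Algebra k B] (r : k) : Module.End B (Coord B) :=
  blockOp (fun m => rootPow r m • 1) 0

/-- The matrix of right multiplication by `Q` on the powers of `Q`. -/
def shiftMatrix (B : Type*) [CommRing B] : Matrix (Fin 3) (Fin 3) B :=
  !![0, 0, 0; 1, 0, 0; 0, 1, 0]

/-- Right multiplication by `Q`. -/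
def opQ (B : Type*) [CommRing B] : Module.End B (Coord B) :=
  blockOp (fun _ => shiftMatrix B) (-1)

/-- The matrix of right multiplication by `P`, as a map from the span of the `Qˡ eₘ₊₁` to the
span of the `Qˡ eₘ`, with `μ = rᵐ`. Its columns come from `Qˡ eₘ₊₁ P = Qˡ P eₘ` by moving `P` to the
left past `Qˡ` and then writing it as `x - (a - 1)/3 - Q`, where `x` acts from the left as `s`. -/
def hMatrix (r : k) (s : B) (μ : k) : Matrix (Fin 3) (Fin 3) B :=
  !![s + algebraMap k B ((1 - μ) / 3), algebraMap k B (-r / (3 * (1 - r)) * (1 - μ ^ 2)), 0;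
    -1, algebraMap k B r * s + algebraMap k B (r * (1 - r ^ 2 * μ) / 3),
      algebraMap k B (1 / (3 * (1 - r)) * (1 - r ^ 2 * μ ^ 2));
    0, algebraMap k B (-r), algebraMap k B (r ^ 2) * s + algebraMap k B (r ^ 2 * (1 - r * μ) / 3)]

/-- Right multiplication by `P`. -/
def opP (r : k) (s : B) : Module.End B (Coord B) :=
  blockOp (fun m => hMatrix r s (rootPow r m)) 1

/-- Right multiplication by `b`. -/
def opB (B : Type*) [CommRing B] : Module.End B (Coord B) where
  toFun v i := v (i + 1)
  map_add' _ _ := rfl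
  map_smul' _ _ := rfl

/-- Right multiplication by `y`. -/
def opY (t : B) : Module.End B (Coord B) where
  toFun v i := ((-1) ^ (i : ℕ) * t) • v i
  map_add' v w := by ext; simp [mul_add]
  map_smul' c v := by ext; simp; ring

/-- The constants in the entries of `hMatrix` are polynomials in two elements `θ = 1/3` and `R = r`
of `B`, so that the matrix identities below reduce to polynomial identities. -/
theorem algebraMap_consts (hr : IsPrimitiveRoot r 3) : ∃ θ R : B, 3 * θ = 1 ∧
    R = algebraMap k B r ∧ R ^ 2 + R + 1 = 0 ∧ algebraMap k B (3⁻¹) = θ ∧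
    algebraMap k B ((1 - r)⁻¹) = θ * (2 + R) := by
  have h3 := three_ne hr
  refine ⟨algebraMap k B 3⁻¹, algebraMap k B r, ?_, rfl, ?_, rfl, ?_⟩
  · rw [← map_ofNat (algebraMap k B) 3, ← map_mul, mul_inv_cancel₀ h3, map_one]
  · rw [← map_pow, ← map_add, ← map_one (algebraMap k B), ← map_add, root_eq hr, map_zero]
  · rw [← map_ofNat (algebraMap k B) 2, ← map_add, ← map_mul]
    congr 1
    have h0 := root_eq hr
    field_simp
    grind

/-- The matrix form of the commutation relation between `P` and `Q`. -/
theorem hMatrix_commutator (hr : IsPrimitiveRoot r 3) (s : B) (μ : k) :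
    shiftMatrix B * hMatrix r s (r ^ 2 * μ) =
      r ^ 2 • (hMatrix r s μ * shiftMatrix B) + (1 / (3 * (1 - r)) * (1 - μ ^ 2)) • 1 := by
  obtain ⟨θ, R, hθ, hR, hR', hθ', hκ⟩ := algebraMap_consts (B := B) hr
  have hsm : ∀ (c : k) (z : B), c • z = algebraMap k B c * z := Algebra.smul_def
  ext i j
  fin_cases i <;> fin_cases j <;>
    simp [shiftMatrix, hMatrix, mul_apply, Fin.sum_univ_three, hsm, div_eq_mul_inv, ← hR, hθ',
      hκ] <;>
    grind

/-- The matrix form of the relation `P³ = x² + x³`. -/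
theorem hMatrix_cube (hr : IsPrimitiveRoot r 3) (s : B) {μ : k} (hμ : μ ^ 3 = 1) :
    hMatrix r s μ * hMatrix r s (r * μ) * hMatrix r s (r * (r * μ)) = (s ^ 2 + s ^ 3) • 1 := by
  obtain ⟨θ, R, hθ, hR, hR', hθ', hκ⟩ := algebraMap_consts (B := B) hr
  have hM : algebraMap k B μ ^ 3 = 1 := by rw [← map_pow, hμ, map_one]
  ext i j
  fin_cases i <;> fin_cases j <;>
    simp [hMatrix, mul_apply, Fin.sum_univ_three, div_eq_mul_inv, ← hR, hθ', hκ] <;>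
    grind

theorem shiftMatrix_cube : shiftMatrix B * shiftMatrix B * shiftMatrix B = 0 := by
  ext i j
  fin_cases i <;> fin_cases j <;> simp [shiftMatrix]

/-- Right multiplication by the generators satisfies the relations of `A`, in the opposite of the
endomorphism ring. -/
theorem coord_eigenSatisfies (hr : IsPrimitiveRoot r 3) {s t : B} (hst : t ^ 2 = s ^ 2 + s ^ 3) :
    EigenSatisfies r (op (opA B r)) (op (opB B)) (op (opP r s)) (op (opQ B)) (op (opY t)) := by
  have h3 := r_pow_three hr
  have hz' : (1 : ZMod 3) + (1 + 1) = 0 := by decide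
  refine ⟨⟨?_, ?_, ?_, ?_, ?_⟩, ?_, ?_, ?_, ?_, ?_, ?_, ?_, ?_, ?_⟩ <;> apply unop_injective
  · change opA B r ^ 3 = 1
    rw [pow_succ, pow_two, opA, blockOp_mul, blockOp_mul, ← blockOp_one]
    congr 1
    · funext m
      simp only [smul_mul_smul, mul_one, add_zero]
      rw [← pow_two, ← pow_succ, rootPow_pow_three hr, one_smul]
  · change opA B r * opP r s = r ^ 2 • (opP r s * opA B r)
    rw [opA, opP, blockOp_mul, blockOp_mul, blockOp_smul, add_comm]
    congr 1
    funext m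
    simp only [rootPow_add_one hr, smul_mul_assoc, mul_smul_comm, one_mul, mul_one, smul_smul,
      add_zero]
    rw [← mul_assoc, ← pow_succ, h3, one_mul]
  · change opA B r * opQ B = r • (opQ B * opA B r)
    rw [opA, opQ, blockOp_mul, blockOp_mul, blockOp_smul, add_comm]
    congr 1
    funext m
    simp only [← sub_eq_add_neg, rootPow_sub_one hr, smul_mul_assoc, mul_smul_comm, one_mul,
      mul_one, smul_smul]
    rw [← mul_assoc, ← pow_succ', h3, one_mul]
  · change opQ B * opP r s = r ^ 2 • (opP r s * opQ B) + (1 / (3 * (1 - r))) • (1 - opA B r ^ 2)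
    have ha : (1 / (3 * (1 - r))) • (1 - opA B r ^ 2) =
        blockOp (fun m => (1 / (3 * (1 - r)) * (1 - rootPow r m ^ 2)) •
          (1 : Matrix (Fin 3) (Fin 3) B)) 0 := by
      refine LinearMap.ext fun v => ?_
      funext i m
      simp [opA, pow_two, smul_mulVec, sub_mulVec, mul_sub, sub_smul, smul_sub, smul_smul]
    rw [ha, opP, opQ, blockOp_mul, blockOp_mul, blockOp_smul, add_neg_cancel, neg_add_cancel,
      blockOp_add]
    congr 1
    funext m
    rw [← sub_eq_add_neg, rootPow_sub_one hr, hMatrix_commutator hr]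
  · change opQ B ^ 3 = 0
    rw [pow_succ, pow_two, opQ, blockOp_mul, blockOp_mul, shiftMatrix_cube]
    refine LinearMap.ext fun v => ?_
    funext i m
    simp
  · rfl
  · rfl
  · rfl
  · change opA B r * opY t = opY t * opA B r
    refine LinearMap.ext fun v => ?_
    funext i m
    simp only [Module.End.mul_apply, opA, opY, blockOp_apply, smul_mulVec, one_mulVec, add_zero,
      LinearMap.coe_mk, AddHom.coe_mk, Pi.smul_apply]
    rw [smul_comm]
  · change opP r s * opY t = opY t * opP r s
    refine LinearMap.ext fun v => ?_
    funext i m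
    simp [opP, opY, mulVec_smul]
  · change opQ B * opY t = opY t * opQ B
    refine LinearMap.ext fun v => ?_
    funext i m
    simp [opQ, opY, mulVec_smul]
  · change opY t * opB B = -(opB B * opY t)
    refine LinearMap.ext fun v => ?_
    funext i m
    fin_cases i <;> simp [opY, opB]
  · change opB B ^ 2 = 1
    refine LinearMap.ext fun v => ?_
    funext i m
    fin_cases i <;> simp [opB, pow_two]
  · change opY t ^ 2 = opP r s ^ 3
    rw [pow_succ (opP r s), pow_two (opP r s), opP, blockOp_mul, blockOp_mul, add_assoc, hz']
    refine LinearMap.ext fun v => ?_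
    funext i m
    rw [blockOp_apply, ← add_assoc, rootPow_add_one hr, rootPow_add_one hr, rootPow_add_one hr,
      hMatrix_cube hr s (rootPow_pow_three hr m), smul_mulVec, one_mulVec, add_zero, ← hst]
    fin_cases i <;> simp [opY, pow_two, smul_smul]

end Representation


/-! ### The coordinate ring of the cubic -/

namespace CubicRing

open MvPolynomial

variable {k : Type u} [Field k]

/-- The coordinate function `s`. -/
noncomputable def s (k : Type u) [Field k] : CubicRing k := CubicRing.mk k (X 0)

/-- The coordinate function `t`. -/
noncomputable def t (k : Type u) [Field k] : CubicRing k := CubicRing.mk k (X 1)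

theorem t_sq : t k ^ 2 = s k ^ 2 + s k ^ 3 := by
  rw [← sub_eq_zero, s, t, ← map_pow, ← map_pow, ← map_pow, ← map_add, ← map_sub]
  refine Ideal.Quotient.eq_zero_iff_mem.mpr (Ideal.subset_span ?_)
  rw [Set.mem_singleton_iff]
  ring

theorem induction {p : CubicRing k → Prop} (hc : ∀ c : k, p (algebraMap k _ c))
    (hs : ∀ β, p β → p (β * s k)) (ht : ∀ β, p β → p (β * t k))
    (hadd : ∀ β γ, p β → p γ → p (β + γ)) (β : CubicRing k) : p β := by
  obtain ⟨f, rfl⟩ := Ideal.Quotient.mk_surjective β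
  change p (CubicRing.mk k f)
  induction f using MvPolynomial.induction_on with
  | C c => exact hc c
  | add f g hf hg => rw [map_add]; exact hadd _ _ hf hg
  | mul_X f i hf =>
    rw [map_mul]
    fin_cases i
    · exact hs _ hf
    · exact ht _ hf

section Lift

variable {T : Type*} [Ring T] [Algebra k T] (x y : T) (hxy : Commute x y)
  (h : y ^ 2 = x ^ 2 + x ^ 3)

open scoped IsMulCommutative in
/-- The algebra map from the coordinate ring of the cubic to an arbitrary (not necessarily
commutative) algebra given by a commuting pair of solutions of the equation of the cubic. -/
noncomputable def lift : CubicRing k →ₐ[k] T :=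
  have : IsMulCommutative (Algebra.adjoin k ({x, y} : Set T)) :=
    Algebra.isMulCommutative_adjoin k (by
      rintro _ (rfl | rfl) _ (rfl | rfl)
      exacts [rfl, hxy, hxy.symm, rfl])
  letI f : MvPolynomial (Fin 2) k →ₐ[k] Algebra.adjoin k ({x, y} : Set T) :=
    aeval (![⟨x, Algebra.subset_adjoin (by simp)⟩, ⟨y, Algebra.subset_adjoin (by simp)⟩] :
      Fin 2 → Algebra.adjoin k ({x, y} : Set T))
  Ideal.Quotient.liftₐ _ ((Algebra.adjoin k ({x, y} : Set T)).val.comp f) (by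
    intro a ha
    induction ha using Submodule.span_induction with
    | mem a ha =>
      rw [Set.mem_singleton_iff] at ha
      simp [ha, f, h]
    | zero => simp
    | add a b _ _ ha hb => rw [map_add, ha, hb, add_zero]
    | smul c a _ ha => rw [smul_eq_mul, map_mul, ha, mul_zero])

@[simp] theorem lift_s : lift x y hxy h (s k) = x := by
  change (((Algebra.adjoin k ({x, y} : Set T)).val.comp _) (X 0 : MvPolynomial (Fin 2) k)) = x
  simp

@[simp] theorem lift_t : lift x y hxy h (t k) = y := by
  change (((Algebra.adjoin k ({x, y} : Set T)).val.comp _) (X 1 : MvPolynomial (Fin 2) k)) = y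
  simp

end Lift

/-- Evaluation at the singular point. -/
noncomputable def eval₀ : CubicRing k →ₐ[k] k := lift 0 0 (.all _ _) (by simp)

theorem eval₀_mk (f : MvPolynomial (Fin 2) k) : eval₀ (CubicRing.mk k f) = eval 0 f := by
  have : eval₀.comp (CubicRing.mk k) = MvPolynomial.aeval (0 : Fin 2 → k) := by
    ext i
    fin_cases i
    · exact (lift_s (k := k) 0 0 (.all _ _) (by simp)).trans (by simp)
    · exact (lift_t (k := k) 0 0 (.all _ _) (by simp)).trans (by simp)
  exact congr($this f)

/-- The tangent vector `(1, 0)` at the singular point. -/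
noncomputable def tangentS : CubicRing k →ₐ[k] DualNumber k :=
  lift DualNumber.eps 0 (.all _ _) (by simp [pow_succ])

/-- The tangent vector `(0, 1)` at the singular point. -/
noncomputable def tangentT : CubicRing k →ₐ[k] DualNumber k :=
  lift 0 DualNumber.eps (.all _ _) (by simp [pow_succ])

theorem fst_tangentS (β : CubicRing k) : (tangentS β).fst = eval₀ β := by
  induction β using induction with
  | hc c => simp [TrivSqZeroExt.algebraMap_eq_inl]
  | hs β h => simp [tangentS, eval₀]
  | ht β h => simp [tangentS, eval₀]
  | hadd β γ h₁ h₂ => simp [h₁, h₂]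

theorem fst_tangentT (β : CubicRing k) : (tangentT β).fst = eval₀ β := by
  induction β using induction with
  | hc c => simp [TrivSqZeroExt.algebraMap_eq_inl]
  | hs β h => simp [tangentT, eval₀]
  | ht β h => simp [tangentT, eval₀]
  | hadd β γ h₁ h₂ => simp [h₁, h₂]

/-- The coordinate ring is free over `k[s]` with basis `1`, `t`: this map gives the coordinates. -/
noncomputable def toQuadratic :
    CubicRing k →ₐ[k] QuadraticAlgebra (Polynomial k) (.X ^ 2 + .X ^ 3) 0 :=
  lift ⟨.X, 0⟩ ⟨0, 1⟩ (.all _ _) (by ext <;> simp [pow_succ])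

theorem exists_eq (β : CubicRing k) : ∃ p q : Polynomial k,
    β = Polynomial.aeval (s k) p + Polynomial.aeval (s k) q * t k := by
  induction β using induction with
  | hc c => exact ⟨.C c, 0, by simp⟩
  | hs β h =>
    obtain ⟨p, q, rfl⟩ := h
    exact ⟨p * .X, q * .X, by simp; ring⟩
  | ht β h =>
    obtain ⟨p, q, rfl⟩ := h
    refine ⟨q * (.X ^ 2 + .X ^ 3), p, ?_⟩
    simp only [map_mul, map_add, map_pow, Polynomial.aeval_X, ← t_sq]
    ring
  | hadd β γ h₁ h₂ =>
    obtain ⟨p, q, rfl⟩ := h₁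
    obtain ⟨p', q', rfl⟩ := h₂
    exact ⟨p + p', q + q', by simp; ring⟩

theorem toQuadratic_aeval (p : Polynomial k) :
    toQuadratic (Polynomial.aeval (s k) p) = ⟨p, 0⟩ := by
  have : toQuadratic.comp (Polynomial.aeval (s k)) =
      IsScalarTower.toAlgHom k (Polynomial k) (QuadraticAlgebra (Polynomial k) _ _) := by
    apply Polynomial.algHom_ext
    simp [toQuadratic, QuadraticAlgebra.algebraMap_eq]
  exact congr($this p)

theorem toQuadratic_aeval_add (p q : Polynomial k) :
    toQuadratic (Polynomial.aeval (s k) p + Polynomial.aeval (s k) q * t k) = ⟨p, q⟩ := by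
  rw [map_add, map_mul, toQuadratic_aeval, toQuadratic_aeval, toQuadratic, lift_t]
  ext <;> simp

theorem aeval_s_injective : Function.Injective (Polynomial.aeval (R := k) (s k)) := by
  intro p q h
  have := congrArg toQuadratic h
  rw [toQuadratic_aeval, toQuadratic_aeval] at this
  exact congrArg QuadraticAlgebra.re this

theorem eq_zero_of_s_mul {β : CubicRing k} (h : s k * β = 0) : β = 0 := by
  obtain ⟨p, q, rfl⟩ := exists_eq β
  have h' := congrArg toQuadratic h
  rw [map_mul, toQuadratic_aeval_add, map_zero, toQuadratic, lift_s] at h'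
  have hp := congrArg QuadraticAlgebra.re h'
  have hq := congrArg QuadraticAlgebra.im h'
  simp at hp hq
  simp [hp, hq]

end CubicRing


/-! ### Freeness over the coordinate ring of the cubic -/

section Generators

variable {k : Type u} [Field k] {r : k} (hr : IsPrimitiveRoot r 3)

/-- The eigenvector component `P` of `x`. -/
noncomputable def A.P : A hr := (r ^ 2 - r)⁻¹ • (A.a hr ^ 2 * elemE r (A.a hr) (A.x hr))

/-- The eigenvector component `Q` of `x`. -/
noncomputable def A.Q : A hr := (r - r ^ 2)⁻¹ • (A.a hr ^ 2 * elemF r (A.a hr) (A.x hr))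

theorem A.eigen : EigenSatisfies r (A.a hr) (A.b hr) (A.P hr) (A.Q hr) (A.y hr) :=
  (A.satisfies hr).eigen hr

theorem A.x_eq : A.x hr = (3 : k)⁻¹ • (A.a hr - 1) + A.P hr + A.Q hr :=
  (A.satisfies hr).x_eq hr

theorem sub_sq_ne {k : Type u} [Field k] {r : k} (hr : IsPrimitiveRoot r 3) : r - r ^ 2 ≠ 0 := by
  rw [show r - r ^ 2 = r * (1 - r) by ring]
  exact mul_ne_zero (hr.ne_zero (by norm_num)) (one_sub_ne hr)

theorem A.F_eq : A.F hr = (r - r ^ 2) • (A.a hr * A.Q hr) := by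
  rw [A.F, A.x_eq, (A.eigen hr).elemF_eq hr]

theorem A.E_eq : A.E hr = (r ^ 2 - r) • (A.a hr * A.P hr) := by
  rw [A.E, A.x_eq, (A.eigen hr).elemE_eq]

/-- The embedding of the coordinate ring of the cubic, given by `s ↦ x`, `t ↦ y`. -/
noncomputable def A.cubicHom : CubicRing k →ₐ[k] A hr :=
  CubicRing.lift (A.x hr) (A.y hr) (A.satisfies hr).yx.symm (A.satisfies hr).cubic

@[simp] theorem A.cubicHom_s : A.cubicHom hr (CubicRing.s k) = A.x hr :=
  CubicRing.lift_s ..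

@[simp] theorem A.cubicHom_t : A.cubicHom hr (CubicRing.t k) = A.y hr :=
  CubicRing.lift_t ..

/-- The idempotent of `k[a]` on which `a` acts by `rᵐ`. -/
noncomputable def A.idem (m : ZMod 3) : A hr :=
  (3 : k)⁻¹ • (1 + rootPow r m ^ 2 • A.a hr + rootPow r m • A.a hr ^ 2)

theorem A.a_mul_idem (m : ZMod 3) : A.a hr * A.idem hr m = rootPow r m • A.idem hr m := by
  have h := rootPow_pow_three hr m
  have ha : A.a hr * (A.a hr * A.a hr) = 1 := by
    rw [← (A.eigen hr).aaa, pow_succ, pow_two, mul_assoc]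
  rw [A.idem]
  generalize rootPow r m = μ at h
  simp only [mul_smul_comm, mul_add, mul_one, pow_two (A.a hr), ha, smul_add, smul_smul]
  match_scalars <;> grind

theorem A.idem_mul_a (m : ZMod 3) : A.idem hr m * A.a hr = rootPow r m • A.idem hr m := by
  have : Commute (A.idem hr m) (A.a hr) :=
    (((Commute.one_left _).add_left ((Commute.refl _).smul_left _)).add_left
      (((Commute.refl _).pow_left 2).smul_left _)).smul_left _
  rw [this.eq, A.a_mul_idem]

theorem A.idem_mul_Q (m : ZMod 3) : A.idem hr m * A.Q hr = A.Q hr * A.idem hr (m + 1) := by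
  have h := r_pow_three hr
  obtain ⟨-, -, ⟨q1, q2⟩, -, -⟩ := (A.eigen hr).assoc
  simp only [A.idem, rootPow_add_one hr, smul_mul_assoc, mul_smul_comm, mul_add, add_mul, one_mul,
    mul_one, pow_two (A.a hr), q1, q2, smul_add, smul_smul, mul_assoc]
  match_scalars <;> grind

theorem A.idem_mul_P (m : ZMod 3) : A.idem hr m * A.P hr = A.P hr * A.idem hr (m - 1) := by
  have h := r_pow_three hr
  obtain ⟨-, ⟨p1, p2⟩, -, -, -⟩ := (A.eigen hr).assoc
  simp only [A.idem, rootPow_sub_one hr, smul_mul_assoc, mul_smul_comm, mul_add, add_mul, one_mul,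
    mul_one, pow_two (A.a hr), p1, p2, smul_add, smul_smul, mul_assoc]
  match_scalars <;> grind

theorem A.sum_idem : ∑ m, A.idem hr m = 1 := by
  have h0 := root_eq hr
  have h3 := three_ne hr
  have hsum : ∑ m, A.idem hr m = A.idem hr 0 + A.idem hr 1 + A.idem hr 2 :=
    Fin.sum_univ_three (A.idem hr : Fin 3 → A hr)
  rw [hsum]
  change (3 : k)⁻¹ • (1 + (r ^ 0) ^ 2 • A.a hr + r ^ 0 • A.a hr ^ 2) +
    (3 : k)⁻¹ • (1 + (r ^ 1) ^ 2 • A.a hr + r ^ 1 • A.a hr ^ 2) +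
    (3 : k)⁻¹ • (1 + (r ^ 2) ^ 2 • A.a hr + r ^ 2 • A.a hr ^ 2) = 1
  match_scalars <;> field_simp <;> grind

/-- The elements `Qˡ eₘ bⁱ`, which form a basis of `A` over the coordinate ring of the cubic; the
index is the triple `(i, m, l)`. -/
noncomputable def A.basisElem (j : Fin 2 × ZMod 3 × Fin 3) : A hr :=
  A.Q hr ^ (j.2.2 : ℕ) * A.idem hr j.2.1 * A.b hr ^ (j.1 : ℕ)

end Generators

section Coordinates

open MulOpposite Matrix

variable {k : Type u} [Field k] {r : k} (hr : IsPrimitiveRoot r 3)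

/-- Right multiplication of `A` on coordinates with respect to the elements `Qˡ eₘ bⁱ`. It reverses
products, whence the opposite algebra. -/
noncomputable def A.rho : A hr →ₐ[k] (Module.End (CubicRing k) (Coord (CubicRing k)))ᵐᵒᵖ :=
  A.lift hr _ _ _ _ ((coord_eigenSatisfies hr CubicRing.t_sq).satisfies hr)

/-- The coordinates of the unit element, which is the sum of the idempotents `eₘ`. -/
def coordOne (B : Type*) [CommRing B] : Coord B := fun i _ => if i = 0 then ![1, 0, 0] else 0

/-- The coordinates of an element of `A` with respect to the elements `Qˡ eₘ bⁱ`, defined by letting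
the element act on the coordinates of `1 = ∑ eₘ`. -/
noncomputable def A.coord (u : A hr) : Coord (CubicRing k) := (A.rho hr u).unop (coordOne _)

theorem A.coord_mul (u v : A hr) : A.coord hr (u * v) = (A.rho hr v).unop (A.coord hr u) := by
  rw [A.coord, map_mul]
  rfl

theorem A.coord_add (u v : A hr) : A.coord hr (u + v) = A.coord hr u + A.coord hr v := by
  rw [A.coord, map_add]
  rfl

theorem A.coord_smul (c : k) (u : A hr) : A.coord hr (c • u) = c • A.coord hr u := by
  rw [A.coord, map_smul]
  rfl

theorem A.coord_one : A.coord hr 1 = coordOne _ := by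
  rw [A.coord, map_one]
  rfl

theorem A.rho_a : (A.rho hr (A.a hr)).unop = opA _ r := by simp [A.rho]
theorem A.rho_b : (A.rho hr (A.b hr)).unop = opB _ := by simp [A.rho]
theorem A.rho_y : (A.rho hr (A.y hr)).unop = opY (CubicRing.t k) := by simp [A.rho]
theorem A.rho_x : A.rho hr (A.x hr) = (3 : k)⁻¹ • (op (opA _ r) - 1) + op (opP r (CubicRing.s k))
    + op (opQ _) := by
  simp [A.rho]

theorem map_elemE {S T : Type*} [Ring S] [Algebra k S] [Ring T] [Algebra k T]
    (f : S →ₐ[k] T) (a x : S) : f (elemE r a x) = elemE r (f a) (f x) := by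
  simp [elemE]

theorem A.rho_Q : (A.rho hr (A.Q hr)).unop = opQ _ := by
  have h := coord_eigenSatisfies (B := CubicRing k) hr CubicRing.t_sq
  have e : A.rho hr (A.a hr) = op (opA _ r) := by simp [A.rho]
  have : A.rho hr (A.Q hr) = op (opQ _) := by
    rw [A.Q, map_smul, map_mul, map_pow, A.map_elemF, A.rho_x, e, h.elemF_eq hr,
      mul_smul_comm, smul_smul, inv_mul_cancel₀ (sub_sq_ne hr), one_smul, ← mul_assoc, ← pow_succ,
      h.aaa, one_mul]
  rw [this, unop_op]

theorem A.rho_P : (A.rho hr (A.P hr)).unop = opP r (CubicRing.s k) := by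
  have h := coord_eigenSatisfies (B := CubicRing k) hr CubicRing.t_sq
  have e : A.rho hr (A.a hr) = op (opA _ r) := by simp [A.rho]
  have h2 : r ^ 2 - r ≠ 0 := by
    rw [← neg_sub]; exact neg_ne_zero.mpr (sub_sq_ne hr)
  have : A.rho hr (A.P hr) = op (opP r (CubicRing.s k)) := by
    rw [A.P, map_smul, map_mul, map_pow, map_elemE, A.rho_x, e, h.elemE_eq,
      mul_smul_comm, smul_smul, inv_mul_cancel₀ h2, one_smul, ← mul_assoc, ← pow_succ,
      h.aaa, one_mul]
  rw [this, unop_op]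

/-- Right and left multiplication by `x` agree on the unit element. -/
theorem opX_coordOne (hr : IsPrimitiveRoot r 3) {B : Type*} [CommRing B] [Algebra k B] (s : B) :
    ((3 : k)⁻¹ • (opA B r - 1) + opP r s + opQ B) (coordOne B) = s • coordOne B := by
  funext i m
  have ha : opA B r (coordOne B) i m = rootPow r m • coordOne B i m := by
    simp [opA, smul_mulVec]
  have hP : opP r s (coordOne B) i m = hMatrix r s (rootPow r m) *ᵥ coordOne B i m := rfl
  have hQ : opQ B (coordOne B) i m = shiftMatrix B *ᵥ coordOne B i m := rfl
  simp only [LinearMap.add_apply, LinearMap.smul_apply, LinearMap.sub_apply, Module.End.one_apply,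
    Pi.add_apply, Pi.smul_apply, Pi.sub_apply, ha, hP, hQ]
  obtain ⟨θ, R, hθ, hR, hR', hθ', hκ⟩ := algebraMap_consts (B := B) hr
  have hsm : ∀ (c : k) (z : B), c • z = algebraMap k B c * z := Algebra.smul_def
  fin_cases i
  · ext l
    fin_cases l <;>
      simp [coordOne, hMatrix, shiftMatrix, vecHead, vecTail, hsm, div_eq_mul_inv, hθ']
    ring
  · simp [coordOne]

/-- The coordinate map sends the image of `β` to `β • 1`. -/
theorem A.coord_cubicHom (β : CubicRing k) : A.coord hr (A.cubicHom hr β) = β • coordOne _ := by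
  induction β using CubicRing.induction with
  | hc c =>
    rw [AlgHom.commutes, Algebra.algebraMap_eq_smul_one, A.coord_smul, A.coord_one, algebraMap_smul]
  | hs β h =>
    rw [map_mul, A.coord_mul, h, map_smul]
    refine Eq.trans ?_ (mul_smul β (CubicRing.s k) (coordOne (CubicRing k))).symm
    rw [A.cubicHom_s, A.rho_x]
    exact congrArg (β • ·) (opX_coordOne hr _)
  | ht β h =>
    rw [map_mul, A.coord_mul, h, map_smul]
    refine Eq.trans ?_ (mul_smul β (CubicRing.t k) (coordOne (CubicRing k))).symm
    rw [A.cubicHom_t, A.rho_y]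
    congr 1
    funext i m
    fin_cases i <;> simp [opY, coordOne]
  | hadd β γ h₁ h₂ => rw [map_add, A.coord_add, h₁, h₂, add_smul]

theorem A.coord_cubicHom_mul (β : CubicRing k) (u : A hr) :
    A.coord hr (A.cubicHom hr β * u) = β • A.coord hr u := by
  rw [A.coord_mul, A.coord_cubicHom, map_smul]
  rfl

theorem A.cubicHom_injective : Function.Injective (A.cubicHom hr) := by
  intro β γ h
  have := congrFun (congrFun (congrFun (congrArg (A.coord hr) h) 0) 0) 0
  simpa [A.coord_cubicHom, coordOne] using this

/-- Orthogonality of the characters of `ℤ/3`. -/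
theorem idem_coeff (hr : IsPrimitiveRoot r 3) (m n : ZMod 3) :
    (3 : k)⁻¹ * (1 + rootPow r m ^ 2 * rootPow r n + rootPow r m * rootPow r n ^ 2) =
      if n = m then 1 else 0 := by
  have h0 := root_eq hr
  have h3 := three_ne hr
  have hm := rootPow_pow_three hr m
  have hcases : ∀ n m : ZMod 3, n = m ∨ n = m + 1 ∨ n = m + 1 + 1 := by decide
  have hne : ∀ m : ZMod 3, m + 1 ≠ m := by decide
  have hne' : ∀ m : ZMod 3, m + 1 + 1 ≠ m := by decide
  rcases hcases n m with rfl | rfl | rfl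
  · rw [if_pos rfl]
    field_simp
    linear_combination 2 * hm
  · rw [if_neg (hne m), rootPow_add_one hr]
    grind
  · rw [if_neg (hne' m), rootPow_add_one hr, rootPow_add_one hr]
    grind

theorem A.rho_idem (m : ZMod 3) (v : Coord (CubicRing k)) (i : Fin 2) (n : ZMod 3) :
    (A.rho hr (A.idem hr m)).unop v i n = if n = m then v i n else 0 := by
  have e : A.rho hr (A.a hr) = op (opA _ r) := by simp [A.rho]
  have h : (A.rho hr (A.idem hr m)).unop v i n = ((3 : k)⁻¹ *
      (1 + rootPow r m ^ 2 * rootPow r n + rootPow r m * rootPow r n ^ 2)) • v i n := by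
    simp only [A.idem, map_smul, map_add, map_one, pow_two (A.a hr), map_mul, e,
      MulOpposite.unop_smul,
      MulOpposite.unop_add, MulOpposite.unop_one, MulOpposite.unop_mul, unop_op,
      LinearMap.smul_apply, LinearMap.add_apply, Module.End.one_apply, Module.End.mul_apply,
      Pi.smul_apply, Pi.add_apply, opA, blockOp_apply, smul_mulVec, one_mulVec, add_zero]
    module
  rw [h, idem_coeff hr]
  split_ifs <;> simp

theorem opQ_pow_coordOne {B : Type*} [CommRing B] (l : Fin 3) (i : Fin 2) (m : ZMod 3) :
    (opQ B ^ (l : ℕ)) (coordOne B) i m = if i = 0 then Pi.single l 1 else 0 := by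
  ext n
  fin_cases i <;> fin_cases l <;> fin_cases n <;>
    simp [opQ, coordOne, pow_succ, shiftMatrix, mulVec, dotProduct, Fin.sum_univ_three]

theorem A.coord_basisElem (j : Fin 2 × ZMod 3 × Fin 3) (i : Fin 2) (m : ZMod 3) (l : Fin 3) :
    A.coord hr (A.basisElem hr j) i m l = if j = (i, m, l) then 1 else 0 := by
  obtain ⟨i', m', l'⟩ := j
  have hQ : A.coord hr (A.Q hr ^ (l' : ℕ)) = (opQ _ ^ (l' : ℕ)) (coordOne _) := by
    rw [A.coord, map_pow, MulOpposite.unop_pow, A.rho_Q]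
  have key : A.coord hr (A.basisElem hr (i', m', l')) i m =
      if i' = i ∧ m' = m then Pi.single l' 1 else 0 := by
    rw [A.basisElem, A.coord_mul, A.coord_mul, hQ, map_pow, MulOpposite.unop_pow, A.rho_b]
    fin_cases i' <;> fin_cases i <;>
      simp [opB, A.rho_idem, opQ_pow_coordOne, eq_comm]
  rw [key]
  by_cases h : i' = i ∧ m' = m
  · simp [h, Pi.single_apply, eq_comm]
  · rw [if_neg h, if_neg (fun e => h (by simp_all)), Pi.zero_apply]

/-- The coordinate map sends the elements `Qˡ eₘ bⁱ` to the standard basis and is linear over the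
coordinate ring of the cubic, so these elements are independent. -/
theorem A.linearIndependent_basisElem :
    letI := (A.cubicHom hr).toRingHom.toModule
    LinearIndependent (CubicRing k) (A.basisElem hr) := by
  let _ := (A.cubicHom hr).toRingHom.toModule
  rw [Fintype.linearIndependent_iff]
  intro g hg j
  have h : ∀ s : Finset (Fin 2 × ZMod 3 × Fin 3), A.coord hr (∑ j ∈ s, g j • A.basisElem hr j) =
      ∑ j ∈ s, g j • A.coord hr (A.basisElem hr j) := by
    intro s
    induction s using Finset.induction_on with
    | empty => simp [A.coord]
    | insert j s hj ih =>
      rw [Finset.sum_insert hj, Finset.sum_insert hj, A.coord_add, ih]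
      congr 1
      exact A.coord_cubicHom_mul hr _ _
  have h0 : A.coord hr 0 = 0 := by simp [A.coord]
  have := congrFun (congrFun (congrFun ((h Finset.univ).symm.trans (hg ▸ h0)) j.1) j.2.1) j.2.2
  simpa [Finset.sum_apply, A.coord_basisElem] using this

/-- The span of the elements `Qˡ eₘ bⁱ` contains `1` and is stable under right multiplication by the
generators. -/
theorem A.span_basisElem :
    letI := (A.cubicHom hr).toRingHom.toModule
    Submodule.span (CubicRing k) (Set.range (A.basisElem hr)) = ⊤ := by
  let _ := (A.cubicHom hr).toRingHom.toModule
  set W := Submodule.span (CubicRing k) (Set.range (A.basisElem hr)) with hW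
  have hsm : ∀ (c : k) {u : A hr}, u ∈ W → c • u ∈ W := fun c u hu => by
    have := W.smul_mem (algebraMap k _ c) hu
    rwa [RingHom.toModule_smul, AlgHom.toRingHom_eq_coe, RingHom.coe_coe, AlgHom.commutes,
      ← Algebra.smul_def] at this
  have hx : ∀ {u : A hr}, u ∈ W → A.x hr * u ∈ W := fun {u} hu => by
    have := W.smul_mem (CubicRing.s k) hu
    rwa [RingHom.toModule_smul, AlgHom.toRingHom_eq_coe, RingHom.coe_coe, A.cubicHom_s] at this
  have hy : ∀ {u : A hr}, u ∈ W → A.y hr * u ∈ W := fun {u} hu => by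
    have := W.smul_mem (CubicRing.t k) hu
    rwa [RingHom.toModule_smul, AlgHom.toRingHom_eq_coe, RingHom.coe_coe, A.cubicHom_t] at this
  set a := A.a hr
  set b := A.b hr
  set Q := A.Q hr
  set P := A.P hr
  set y := A.y hr
  have hbb : b ^ 2 = 1 := (A.eigen hr).bb
  have hmem : ∀ (l : ℕ) (m : ZMod 3) (i : Fin 2),
      Q ^ l * (A.idem hr m * b ^ (i : ℕ)) ∈ W := by
    intro l m i
    by_cases hl : l < 3
    · rw [← mul_assoc]
      exact Submodule.subset_span ⟨(i, m, ⟨l, hl⟩), rfl⟩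
    · rw [pow_eq_zero_of_le (not_lt.mp hl) (A.eigen hr).QQQ, zero_mul]
      exact W.zero_mem
  have hPQ : ∀ z, Q * (P * z) =
      r • (P * (Q * z)) - (r * (1 / (3 * (1 - r)))) • (z - a * (a * z)) := by
    intro z
    obtain ⟨-, -, -, ⟨-, h⟩, -⟩ := (A.eigen hr).assoc
    rw [h z, smul_add, smul_smul, smul_smul, ← pow_succ', r_pow_three hr, one_smul,
      add_sub_cancel_right]
  have haw : ∀ (l : ℕ) (m : ZMod 3) (i : Fin 2), ∃ c : k,
      a * (Q ^ l * (A.idem hr m * b ^ (i : ℕ))) = c • (Q ^ l * (A.idem hr m * b ^ (i : ℕ))) := by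
    intro l m i
    induction l with
    | zero =>
      refine ⟨rootPow r m, ?_⟩
      rw [pow_zero, one_mul, ← mul_assoc, A.a_mul_idem, smul_mul_assoc]
    | succ l ih =>
      obtain ⟨c, hc⟩ := ih
      refine ⟨r ^ 2 * c, ?_⟩
      obtain ⟨-, -, ⟨-, h⟩, -, -⟩ := (A.eigen hr).assoc
      have h' : ∀ z, a * (Q * z) = r ^ 2 • (Q * (a * z)) := fun z => by
        rw [h z, smul_smul, ← pow_succ, r_pow_three hr, one_smul]
      rw [pow_succ', mul_assoc, h', hc, mul_smul_comm, smul_smul]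
  -- Left multiplication by `P` preserves the span, since `P = x - (a - 1)/3 - Q` and `a` acts on
  -- the basis by scalars; a power of `Q` to the left of `P` is handled by the commutation relation.
  have hPw : ∀ (n l : ℕ) (m : ZMod 3) (i : Fin 2),
      Q ^ n * (P * (Q ^ l * (A.idem hr m * b ^ (i : ℕ)))) ∈ W := by
    intro n
    induction n with
    | zero =>
      intro l m i
      obtain ⟨c, hc⟩ := haw l m i
      have hP : P = A.x hr - (3 : k)⁻¹ • (a - 1) - Q := by rw [A.x_eq]; abel
      rw [pow_zero, one_mul, hP, sub_mul, sub_mul, smul_mul_assoc, sub_mul, hc, one_mul,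
        ← mul_assoc Q, ← pow_succ']
      exact W.sub_mem (W.sub_mem (hx (hmem l m i))
        (hsm _ (W.sub_mem (hsm _ (hmem l m i)) (hmem l m i)))) (hmem (l + 1) m i)
    | succ n ih =>
      intro l m i
      obtain ⟨c, hc⟩ := haw l m i
      rw [pow_succ Q, mul_assoc, hPQ, hc, mul_smul_comm, hc]
      simp only [mul_sub (Q ^ n), mul_smul_comm]
      rw [← mul_assoc Q, ← pow_succ' Q, ← mul_assoc (Q ^ n) (Q ^ l), ← pow_add Q]
      exact W.sub_mem (hsm _ (ih (l + 1) m i))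
        (hsm _ (W.sub_mem (hmem _ m i) (hsm _ (hsm _ (hmem _ m i)))))
  -- The span is a left module over the coordinate ring, so stability can be checked on the basis.
  have hclosed : ∀ g : A hr, (∀ (l : ℕ) (m : ZMod 3) (i : Fin 2),
      Q ^ l * (A.idem hr m * b ^ (i : ℕ)) * g ∈ W) → ∀ u ∈ W, u * g ∈ W := by
    intro g hg u hu
    induction hu using Submodule.span_induction with
    | mem u hu =>
      obtain ⟨⟨i, m, l⟩, rfl⟩ := hu
      rw [A.basisElem, mul_assoc (A.Q hr ^ _)]
      exact hg l m i
    | zero => rw [zero_mul]; exact W.zero_mem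
    | add u v _ _ hu hv => rw [add_mul]; exact W.add_mem hu hv
    | smul β u _ hu =>
      have : β • u * g = β • (u * g) := mul_assoc _ _ _
      rw [this]
      exact W.smul_mem β hu
  have hba : Commute b a := (A.eigen hr).ba
  have hbP : Commute b P := (A.eigen hr).bP
  have hbQ : Commute b Q := (A.eigen hr).bQ
  have hya : Commute y a := (A.eigen hr).ya
  have hyQ : Commute y Q := (A.eigen hr).yQ
  have hyidem : ∀ m, Commute y (A.idem hr m) := fun m =>
    (((Commute.one_right _).add_right (hya.smul_right _)).add_right
      ((hya.pow_right 2).smul_right _)).smul_right _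
  have mul_a : ∀ u ∈ W, u * a ∈ W := hclosed a fun l m i => by
    rw [mul_assoc, mul_assoc, (hba.pow_left _).eq, ← mul_assoc (A.idem hr m), A.idem_mul_a,
      smul_mul_assoc, mul_smul_comm]
    exact hsm _ (hmem l m i)
  have mul_Q : ∀ u ∈ W, u * Q ∈ W := hclosed Q fun l m i => by
    rw [mul_assoc, mul_assoc, (hbQ.pow_left _).eq, ← mul_assoc (A.idem hr m), A.idem_mul_Q,
      mul_assoc, ← mul_assoc, ← pow_succ]
    exact hmem _ _ i
  have mul_P : ∀ u ∈ W, u * P ∈ W := hclosed P fun l m i => by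
    rw [mul_assoc, mul_assoc, (hbP.pow_left _).eq, ← mul_assoc (A.idem hr m), A.idem_mul_P,
      mul_assoc]
    simpa using hPw l 0 (m - 1) i
  have mul_b : ∀ u ∈ W, u * b ∈ W := hclosed b fun l m i => by
    rw [mul_assoc, mul_assoc, ← pow_succ]
    fin_cases i
    · exact hmem l m 1
    · simpa [hbb] using hmem l m 0
  have mul_y : ∀ u ∈ W, u * y ∈ W := hclosed y fun l m i => by
    have h1 : Q ^ l * (A.idem hr m * y) = y * (Q ^ l * A.idem hr m) := by
      rw [← (hyidem m).eq, ← mul_assoc, ← (hyQ.pow_right l).eq, mul_assoc]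
    fin_cases i
    · simpa [mul_assoc, h1] using hy (hmem l m 0)
    · have h2 := W.neg_mem (hy (hmem l m 1))
      have h3 : b * y = -(y * b) := (A.eigen hr).byy
      simp only [Fin.isValue, Fin.val_one, pow_one] at h2 ⊢
      convert h2 using 1
      rw [mul_assoc, mul_assoc, h3, mul_neg, mul_neg, ← mul_assoc (A.idem hr m),
        ← mul_assoc (Q ^ l), h1, mul_assoc, mul_assoc]
  have mul_x : ∀ u ∈ W, u * A.x hr ∈ W := fun u hu => by
    rw [A.x_eq, mul_add, mul_add, mul_smul_comm, mul_sub, mul_one]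
    exact W.add_mem (W.add_mem (hsm _ (W.sub_mem (mul_a u hu) hu)) (mul_P u hu)) (mul_Q u hu)
  have one_mem : (1 : A hr) ∈ W := by
    rw [← A.sum_idem hr]
    exact W.sum_mem fun m _ => by simpa using hmem 0 m 0
  have mul_mem : ∀ v u : A hr, u ∈ W → u * v ∈ W := by
    intro v
    induction v using A.induction hr with
    | hc c =>
      intro u hu
      rw [← Algebra.commutes, ← Algebra.smul_def]
      exact hsm c hu
    | ha => exact mul_a
    | hb => exact mul_b
    | hx => exact mul_x
    | hy => exact mul_y
    | hmul s t hs ht => intro u hu; rw [← mul_assoc]; exact ht _ (hs _ hu)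
    | hadd s t hs ht => intro u hu; rw [mul_add]; exact W.add_mem (hs u hu) (ht u hu)
  exact eq_top_iff.mpr fun v _ => by simpa using mul_mem v 1 one_mem

/-- `A` is a free left module of rank 18 over the coordinate ring of the cubic. -/
noncomputable def A.cubicBasis :
    letI := (A.cubicHom hr).toRingHom.toModule
    Module.Basis (Fin 2 × ZMod 3 × Fin 3) (CubicRing k) (A hr) :=
  letI := (A.cubicHom hr).toRingHom.toModule
  Module.Basis.mk (A.linearIndependent_basisElem hr) (A.span_basisElem hr).ge

end Coordinates


/-! ### Infinite projective dimension -/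

section Homological

theorem restrictScalars_shortExact {R S : Type u} [Ring R] [Ring S] (f : R →+* S)
    {C : ShortComplex (ModuleCat.{u} S)} (hC : C.ShortExact) :
    (C.map (ModuleCat.restrictScalars f)).ShortExact :=
  ModuleCat.shortComplex_shortExact _
    ((ShortComplex.ShortExact.moduleCat_exact_iff_function_exact C).mp hC.exact)
    hC.moduleCat_injective_f hC.moduleCat_surjective_g

/-- Restriction of scalars along `f : R → S` does not increase projective dimensions when `S` is
projective as a left `R`-module. -/
theorem hasProjectiveDimensionLT_restrictScalars {R S : Type u} [Ring R] [Ring S] (f : R →+* S)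
    (hf : letI := f.toModule; Module.Projective R S) (n : ℕ) (M : ModuleCat.{u} S)
    [HasProjectiveDimensionLT M n] :
    HasProjectiveDimensionLT ((ModuleCat.restrictScalars f).obj M) n := by
  have hproj : ∀ (N : ModuleCat.{u} S), Module.Projective S N →
      Projective ((ModuleCat.restrictScalars f).obj N) := by
    intro N hN
    let _ := f.toModule
    let _ : Module R N := Module.compHom N f
    obtain ⟨i, hi⟩ := hN
    let i' : N →ₗ[R] N →₀ S := { i with map_smul' := fun c x => i.map_smul (f c) x }
    let p : (N →₀ S) →ₗ[R] N :=
      { Finsupp.linearCombination S id with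
        map_smul' := fun c x => (Finsupp.linearCombination S id).map_smul (f c) x }
    classical
    have : Module.Projective R (N →₀ S) :=
      Module.Projective.of_equiv' (finsuppLequivDFinsupp R).symm
    have h : Module.Projective R N := Module.Projective.of_split i' p (LinearMap.ext hi)
    exact (IsProjective.iff_projective N).mp h
  induction n generalizing M with
  | zero =>
    have h := isZero_of_hasProjectiveDimensionLT_zero M
    exact ((ModuleCat.restrictScalars f).map_isZero h).hasProjectiveDimensionLT_zero
  | succ n ih =>
    cases n with
    | zero =>
      have : Projective M := projective_iff_hasProjectiveDimensionLT_one.mpr ‹_›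
      have := hproj M (ModuleCat.projective_of_module_projective M)
      infer_instance
    | succ n =>
      have hS := M.shortExact_projectiveShortComplex
      have hS' := restrictScalars_shortExact f hS
      have h2 : Projective M.projectiveShortComplex.X₂ := inferInstance
      have h2' : Projective (M.projectiveShortComplex.map (ModuleCat.restrictScalars f)).X₂ :=
        hproj _ inferInstance
      have := (hS.hasProjectiveDimensionLT_X₃_iff n h2).mp ‹_›
      exact (hS'.hasProjectiveDimensionLT_X₃_iff n h2').mpr (ih _)

theorem projectiveDimension_eq_top_iff' {R : Type u} [Ring R] (M : ModuleCat.{u} R) :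
    projectiveDimension M = ⊤ ↔ ∀ n, ¬ HasProjectiveDimensionLT M n := by
  rw [← not_iff_not, ← ne_eq, projectiveDimension_ne_top_iff]
  push Not
  exact ⟨fun ⟨n, h⟩ => ⟨n + 1, h⟩,
    fun ⟨n, h⟩ => ⟨n, hasProjectiveDimensionLT_of_ge _ n _ n.le_succ⟩⟩

namespace CubicRing

variable {k : Type u} [Field k]

/-- The maximal ideal of the singular point. -/
noncomputable def maxIdeal (k : Type u) [Field k] : Ideal (CubicRing k) :=
  RingHom.ker (eval₀ (k := k))

@[simp] theorem eval₀_s : eval₀ (s k) = 0 := lift_s ..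
@[simp] theorem eval₀_t : eval₀ (t k) = 0 := lift_t ..
@[simp] theorem tangentS_s : tangentS (s k) = DualNumber.eps := lift_s ..
@[simp] theorem tangentS_t : tangentS (t k) = 0 := lift_t ..
@[simp] theorem tangentT_s : tangentT (s k) = 0 := lift_s ..
@[simp] theorem tangentT_t : tangentT (t k) = DualNumber.eps := lift_t ..

theorem exists_of_mem_maxIdeal {β : CubicRing k} (h : β ∈ maxIdeal k) :
    ∃ u v, u * s k + v * t k = β := by
  have key : ∀ β : CubicRing k, ∃ u v, u * s k + v * t k = β - algebraMap k _ (eval₀ β) := by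
    intro β
    induction β using induction with
    | hc c => exact ⟨0, 0, by simp⟩
    | hs β _ => exact ⟨β, 0, by simp⟩
    | ht β _ => exact ⟨0, β, by simp⟩
    | hadd β γ h₁ h₂ =>
      obtain ⟨u, v, h₁⟩ := h₁
      obtain ⟨u', v', h₂⟩ := h₂
      refine ⟨u + u', v + v', ?_⟩
      rw [map_add, map_add]
      linear_combination h₁ + h₂
  obtain ⟨u, v, huv⟩ := key β
  rw [maxIdeal, RingHom.mem_ker] at h
  exact ⟨u, v, by rw [huv, h, map_zero, sub_zero]⟩

/-- The presentation `(u, v) ↦ u s + v t` of the maximal ideal of the singular point. -/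
noncomputable def presentation (k : Type u) [Field k] :
    (CubicRing k × CubicRing k) →ₗ[CubicRing k] maxIdeal k :=
  LinearMap.codRestrict (maxIdeal k) ((LinearMap.toSpanSingleton _ _ (s k)).coprod
    (LinearMap.toSpanSingleton _ _ (t k))) fun p => by
      simp [maxIdeal, RingHom.mem_ker]

theorem presentation_coe (p : CubicRing k × CubicRing k) :
    (presentation k p : CubicRing k) = p.1 * s k + p.2 * t k := rfl

theorem presentation_surjective : Function.Surjective (presentation k) := by
  rintro ⟨β, h⟩
  obtain ⟨u, v, huv⟩ := exists_of_mem_maxIdeal h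
  exact ⟨(u, v), Subtype.ext huv⟩

/-- The syzygies of the maximal ideal of the singular point form a module isomorphic to this
ideal: for a relation `u s + v t = 0`, the coefficient `v` determines `u` and can be any element of
the ideal. -/
noncomputable def kerPresentationEquiv (k : Type u) [Field k] :
    LinearMap.ker (presentation k) ≃ₗ[CubicRing k] maxIdeal k :=
  have hker : ∀ p : LinearMap.ker (presentation k), p.1.1 * s k + p.1.2 * t k = 0 := fun p =>
    congrArg Subtype.val p.2
  LinearEquiv.ofBijective
    (LinearMap.codRestrict (maxIdeal k)
      (LinearMap.snd _ _ _ ∘ₗ (LinearMap.ker (presentation k)).subtype) fun p => by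
        have := congrArg tangentT (hker p)
        have := congrArg TrivSqZeroExt.snd this
        change eval₀ p.1.2 = 0
        simpa [fst_tangentT] using this)
    (by
      constructor
      · rw [← LinearMap.ker_eq_bot, LinearMap.ker_eq_bot']
        intro p hp
        have h2 : p.1.2 = 0 := congrArg Subtype.val hp
        have h1 := hker p
        rw [h2, zero_mul, add_zero, mul_comm] at h1
        exact Subtype.ext (Prod.ext (eq_zero_of_s_mul h1) h2)
      · rintro ⟨β, h⟩
        obtain ⟨u, v, huv⟩ := exists_of_mem_maxIdeal h
        -- The coefficients `s` and `t` come from the relations `-t s + s t = 0` and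
        -- `-(s + s²) s + t t = 0`.
        refine ⟨⟨(-(u * t k) - v * (s k + s k ^ 2), β), Subtype.ext ?_⟩, rfl⟩
        rw [presentation_coe, ← huv]
        change _ = (0 : CubicRing k)
        linear_combination v * t_sq (k := k))

/-- The maximal ideal of the singular point is not projective: a section of its presentation would
express `s` and `t` in terms of each other to first order. -/
theorem not_projective_maxIdeal : ¬ Module.Projective (CubicRing k) (maxIdeal k) := by
  intro h
  obtain ⟨σ, hσ⟩ := Module.projective_lifting_property (presentation k) LinearMap.id
    presentation_surjective
  have hs : s k ∈ maxIdeal k := eval₀_s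
  have ht : t k ∈ maxIdeal k := eval₀_t
  have h1 : (σ ⟨s k, hs⟩).1 * s k + (σ ⟨s k, hs⟩).2 * t k = s k :=
    congrArg Subtype.val (LinearMap.congr_fun hσ ⟨s k, hs⟩)
  have h2 : t k * (σ ⟨s k, hs⟩).1 = s k * (σ ⟨t k, ht⟩).1 := by
    have : t k • σ ⟨s k, hs⟩ = s k • σ ⟨t k, ht⟩ := by
      rw [← map_smul, ← map_smul]
      congr 1
      exact Subtype.ext (mul_comm _ _)
    exact congrArg Prod.fst this
  have h1' := congrArg TrivSqZeroExt.snd (congrArg tangentS h1)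
  have h2' := congrArg TrivSqZeroExt.snd (congrArg tangentT h2)
  simp [fst_tangentS] at h1'
  simp [fst_tangentT, h1'] at h2'

/-- The maximal ideal of the singular point is its own syzygy module and is not projective, so it
has infinite projective dimension. -/
theorem not_hasProjectiveDimensionLT_maxIdeal (n : ℕ) :
    ¬ HasProjectiveDimensionLT (ModuleCat.of (CubicRing k) (maxIdeal k)) n := by
  have key : ¬ HasProjectiveDimensionLT (ModuleCat.of (CubicRing k) (maxIdeal k)) 1 := fun h =>
    not_projective_maxIdeal (ModuleCat.projective_of_module_projective
      (ModuleCat.of (CubicRing k) (maxIdeal k)))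
  induction n with
  | zero => exact fun h => key (hasProjectiveDimensionLT_of_ge _ 0 _ (by norm_num))
  | succ n ih =>
    cases n with
    | zero => exact key
    | succ n =>
      intro h
      have hS := LinearMap.shortExact_shortComplexKer (presentation_surjective (k := k))
      have := (hS.hasProjectiveDimensionLT_X₃_iff n
        (ModuleCat.projective_of_categoryTheory_projective _)).mp h
      exact ih (hasProjectiveDimensionLT_of_iso (kerPresentationEquiv k).toModuleIso _)

/-- The residue field of the singular point has infinite projective dimension. -/
theorem projectiveDimension_residueField {M : ModuleCat.{u} (CubicRing k)}
    (π : CubicRing k →ₗ[CubicRing k] M) (hπ : Function.Surjective π)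
    (hker : LinearMap.ker π = maxIdeal k) : projectiveDimension M = ⊤ := by
  rw [projectiveDimension_eq_top_iff']
  intro n h
  have h' : HasProjectiveDimensionLT M (n + 2) := hasProjectiveDimensionLT_of_ge _ n _ (by omega)
  have hS := LinearMap.shortExact_shortComplexKer hπ
  have := (hS.hasProjectiveDimensionLT_X₃_iff n
    (ModuleCat.projective_of_categoryTheory_projective _)).mp h'
  exact not_hasProjectiveDimensionLT_maxIdeal (n + 1)
    (hasProjectiveDimensionLT_of_iso (LinearEquiv.ofEq _ _ hker).toModuleIso _)

end CubicRing

end Homological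


/-! ### Gelfand–Kirillov dimension -/

section GKDim

open Polynomial Filter Topology

variable {k : Type*} [Field k] {R : Type*} [Ring R] [Algebra k R]

/-- The combinations of the elements `u j` with coefficients the values of `f` at polynomials of
degree at most `n`. -/
noncomputable def degFiltration (f : k[X] →ₐ[k] R) {N : ℕ} (u : Fin N → R) (n : ℕ) :
    Submodule k R :=
  LinearMap.range (∑ j, LinearMap.mulRight k (u j) ∘ₗ f.toLinearMap ∘ₗ
    (degreeLT k (n + 1)).subtype ∘ₗ LinearMap.proj j :
      (Fin N → degreeLT k (n + 1)) →ₗ[k] R)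

theorem mem_degFiltration {f : k[X] →ₐ[k] R} {N : ℕ} {u : Fin N → R} {n : ℕ} {z : R} :
    z ∈ degFiltration f u n ↔
      ∃ p : Fin N → k[X], (∀ j, (p j).natDegree ≤ n) ∧ ∑ j, f (p j) * u j = z := by
  have hdeg : ∀ p : k[X], p ∈ degreeLT k (n + 1) ↔ p.natDegree ≤ n := fun p => by
    rw [degreeLT_succ_eq_degreeLE, mem_degreeLE, natDegree_le_iff_degree_le]
  constructor
  · rintro ⟨p, rfl⟩
    exact ⟨fun j => p j, fun j => (hdeg _).mp (p j).2, by simp [LinearMap.sum_apply]⟩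
  · rintro ⟨p, hp, rfl⟩
    exact ⟨fun j => ⟨p j, (hdeg _).mpr (hp j)⟩, by simp [LinearMap.sum_apply]⟩

theorem finrank_degFiltration_le (f : k[X] →ₐ[k] R) {N : ℕ} (u : Fin N → R) (n : ℕ) :
    Module.finrank k (degFiltration f u n) ≤ N * (n + 1) := by
  have := Module.Finite.equiv (degreeLTEquiv k (n + 1)).symm
  refine (LinearMap.finrank_range_le _).trans_eq ?_
  rw [Module.finrank_pi_fintype, (degreeLTEquiv k (n + 1)).finrank_eq]
  simp

theorem degFiltration_mono (f : k[X] →ₐ[k] R) {N : ℕ} (u : Fin N → R) :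
    Monotone (degFiltration f u) := by
  intro m n h z hz
  obtain ⟨p, hp, rfl⟩ := mem_degFiltration.mp hz
  exact mem_degFiltration.mpr ⟨p, fun j => (hp j).trans h, rfl⟩

instance (f : k[X] →ₐ[k] R) {N : ℕ} (u : Fin N → R) (n : ℕ) :
    Module.Finite k (degFiltration f u n) := by
  have := Module.Finite.equiv (degreeLTEquiv k (n + 1)).symm
  exact Module.Finite.range _

theorem exists_mem_degFiltration {f : k[X] →ₐ[k] R} {N : ℕ} {u : Fin N → R}
    (hu : ∀ z, ∃ p : Fin N → k[X], ∑ j, f (p j) * u j = z) (z : R) :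
    ∃ n, z ∈ degFiltration f u n := by
  obtain ⟨p, hp⟩ := hu z
  exact ⟨Finset.univ.sup fun j => (p j).natDegree,
    mem_degFiltration.mpr ⟨p, fun j => Finset.le_sup (f := fun j => (p j).natDegree)
      (Finset.mem_univ j), hp⟩⟩

theorem mul_mem_degFiltration {f : k[X] →ₐ[k] R} {N : ℕ} {u : Fin N → R} {n d : ℕ} {p : k[X]}
    {z : R} (hp : p.natDegree ≤ n) (hz : z ∈ degFiltration f u d) :
    f p * z ∈ degFiltration f u (n + d) := by
  obtain ⟨q, hq, rfl⟩ := mem_degFiltration.mp hz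
  refine mem_degFiltration.mpr ⟨fun j => p * q j, fun j => ?_, ?_⟩
  · exact natDegree_mul_le.trans (add_le_add hp (hq j))
  · rw [Finset.mul_sum]
    exact Finset.sum_congr rfl fun j _ => by rw [map_mul, mul_assoc]

/-- Right multiplication by a finite-dimensional subspace raises the degree by a bounded amount. -/
theorem exists_degFiltration_mul_le {f : k[X] →ₐ[k] R} {N : ℕ} {u : Fin N → R}
    (hu : ∀ z, ∃ p : Fin N → k[X], ∑ j, f (p j) * u j = z) {V : Submodule k R} (hV : V.FG) :
    ∃ d, ∀ n, degFiltration f u n * V ≤ degFiltration f u (n + d) := by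
  classical
  obtain ⟨S, rfl⟩ := hV
  choose e he using fun z => exists_mem_degFiltration hu z
  refine ⟨S.sup fun w => Finset.univ.sup fun j => e (u j * w), fun n => ?_⟩
  rw [Submodule.mul_le]
  intro z hz w hw
  induction hw using Submodule.span_induction with
  | mem w hw =>
    obtain ⟨p, hp, rfl⟩ := mem_degFiltration.mp hz
    rw [Finset.sum_mul]
    refine Submodule.sum_mem _ fun j _ => ?_
    rw [mul_assoc]
    refine degFiltration_mono f u (Nat.add_le_add_left ?_ n)
      (mul_mem_degFiltration (hp j) (he (u j * w)))
    exact (Finset.le_sup (f := fun j => e (u j * w)) (Finset.mem_univ j)).trans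
      (Finset.le_sup (f := fun w => Finset.univ.sup fun j => e (u j * w)) hw)
  | zero => rw [mul_zero]; exact Submodule.zero_mem _
  | add v w _ _ hv hw => rw [mul_add]; exact Submodule.add_mem _ hv hw
  | smul c w _ hw => rw [mul_smul_comm]; exact Submodule.smul_mem _ c hw

/-- An algebra that is finitely generated as a left module over a polynomial ring in one variable
(not necessarily central) has Gelfand–Kirillov dimension at most one. -/
theorem gkDim_le_one (f : k[X] →ₐ[k] R) {N : ℕ} (u : Fin N → R)
    (hu : ∀ z, ∃ p : Fin N → k[X], ∑ j, f (p j) * u j = z) : gkDim k R ≤ 1 := by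
  refine iSup_le fun ⟨V, hV⟩ => ?_
  obtain ⟨d, hd⟩ := exists_degFiltration_mul_le hu hV
  obtain ⟨c, hc⟩ := exists_mem_degFiltration hu 1
  -- The powers of `V` grow in degree at a linear rate, so their sums grow in dimension at a linear
  -- rate.
  have hpow : ∀ i : ℕ, V ^ i ≤ degFiltration f u (c + i * d) := by
    intro i
    induction i with
    | zero => rw [pow_zero, zero_mul, add_zero]; exact Submodule.one_le.mpr hc
    | succ i ih =>
      rw [pow_succ]
      refine (mul_le_mul' ih le_rfl).trans ((hd _).trans_eq ?_)
      rw [add_mul, one_mul, add_assoc]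
  set D : ℕ := N * (c + d + 1) + 1 with hD
  have hfin : ∀ n : ℕ, 1 ≤ n →
      Module.finrank k (⨆ i : Fin (n + 1), V ^ (i : ℕ) : Submodule k R) ≤ D * n := by
    intro n hn
    have hle : (⨆ i : Fin (n + 1), V ^ (i : ℕ)) ≤ degFiltration f u (c + n * d) :=
      iSup_le fun i => (hpow i).trans (degFiltration_mono f u (by
        have := Nat.mul_le_mul_right d (Nat.lt_succ_iff.mp i.2)
        omega))
    refine (Submodule.finrank_mono hle).trans ((finrank_degFiltration_le f u _).trans ?_)
    have h1 : c + n * d + 1 ≤ (c + d + 1) * n := by nlinarith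
    calc N * (c + n * d + 1) ≤ N * ((c + d + 1) * n) := Nat.mul_le_mul_left _ h1
      _ ≤ D * n := by rw [hD]; nlinarith
  have htend : Tendsto (fun n : ℕ => (((Real.log D + Real.log n) / Real.log n : ℝ) : EReal))
      atTop (𝓝 ((1 : ℝ) : EReal)) := by
    refine (continuous_coe_real_ereal.tendsto _).comp ?_
    have hlog : Tendsto (fun n : ℕ => Real.log n) atTop atTop :=
      Real.tendsto_log_atTop.comp tendsto_natCast_atTop_atTop
    have h1 : Tendsto (fun n : ℕ => Real.log D / Real.log n + 1) atTop (𝓝 (0 + 1)) :=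
      (hlog.const_div_atTop _).add_const 1
    rw [zero_add] at h1
    refine h1.congr' ?_
    filter_upwards [hlog.eventually_gt_atTop 0] with n hn
    rw [add_div, div_self hn.ne']
  refine le_trans (limsup_le_limsup ?_) htend.limsup_eq.le
  filter_upwards [eventually_ge_atTop 1] with n hn
  rw [EReal.coe_le_coe_iff]
  have hn' : (1 : ℝ) ≤ n := by exact_mod_cast hn
  refine div_le_div_of_nonneg_right ?_ (Real.log_nonneg hn')
  have hD0 : (0 : ℝ) < D := by rw [hD]; positivity
  rw [← Real.log_mul hD0.ne' (by positivity)]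
  have hb : ((Module.finrank k (⨆ i : Fin (n + 1), V ^ (i : ℕ) : Submodule k R) : ℕ) : ℝ) ≤
      D * n := by exact_mod_cast hfin n hn
  rcases Nat.eq_zero_or_pos
      (Module.finrank k (⨆ i : Fin (n + 1), V ^ (i : ℕ) : Submodule k R)) with h0 | h0
  · rw [h0, Nat.cast_zero, Real.log_zero]
    refine Real.log_nonneg ?_
    have : 1 ≤ D * n := Nat.mul_pos (by omega) hn
    exact_mod_cast this
  · exact Real.log_le_log (by exact_mod_cast h0) hb

/-- An algebra containing a polynomial ring in one variable has Gelfand–Kirillov dimension at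
least one. -/
theorem one_le_gkDim (f : k[X] →ₐ[k] R) (hf : Function.Injective f) : 1 ≤ gkDim k R := by
  have hV : (Submodule.span k {f X}).FG := ⟨{f X}, by simp⟩
  refine le_trans ?_ (le_iSup _ (⟨_, hV⟩ : {V : Submodule k R // V.FG}))
  have hfin : ∀ n : ℕ, n + 1 ≤ Module.finrank k
      (⨆ i : Fin (n + 1), Submodule.span k {f X} ^ (i : ℕ) : Submodule k R) := by
    intro n
    set W : Submodule k R := ⨆ i : Fin (n + 1), Submodule.span k {f X} ^ (i : ℕ)
    have : Module.Finite k W := Module.Finite.iff_fg.mpr (Submodule.fg_iSup _ fun i => hV.pow _)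
    have hmem : ∀ i : Fin (n + 1), f (X ^ (i : ℕ)) ∈ W := fun i =>
      (le_iSup (fun i : Fin (n + 1) => Submodule.span k {f X} ^ (i : ℕ)) i) (by
        rw [map_pow]
        exact Submodule.pow_mem_pow _ (Submodule.mem_span_singleton_self _) _)
    have hX : LinearIndependent k fun i : ℕ => (X ^ i : k[X]) := by
      have := (basisMonomials k).linearIndependent
      simpa [coe_basisMonomials, X_pow_eq_monomial] using this
    have hli : LinearIndependent k fun i : Fin (n + 1) => (⟨f (X ^ (i : ℕ)), hmem i⟩ : W) := by
      apply LinearIndependent.of_comp W.subtype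
      exact (hX.comp _ Fin.val_injective).map' f.toLinearMap (LinearMap.ker_eq_bot.mpr hf)
    simpa using hli.fintype_card_le_finrank
  refine le_trans (b := limsup (fun _ : ℕ => (1 : EReal)) atTop) (limsup_const _).ge
    (limsup_le_limsup ?_)
  filter_upwards [eventually_ge_atTop 2] with n hn
  rw [← EReal.coe_one, EReal.coe_le_coe_iff]
  have hn' : (1 : ℝ) < n := by exact_mod_cast hn
  rw [one_le_div (Real.log_pos hn')]
  refine Real.log_le_log (by positivity) ?_
  exact_mod_cast (Nat.le_succ n).trans (hfin n)

end GKDim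


/-! ### The Casimir element -/

section Casimir

variable {k : Type u} [Field k] {r : k} {T : Type*} [Ring T] [Algebra k T]

/-- The Casimir element in eigenvector coordinates, in normal form. -/
def eigenCasimir (r : k) (a P Q : T) : T :=
  (3 * r) • (a * (a * (Q * P))) - (r / 3) • (a * a) - (r ^ 2 / 3) • a

theorem EigenCore.commute_a {a P Q : T} (hr : IsPrimitiveRoot r 3) (h : EigenCore r a P Q) :
    eigenCasimir r a P Q * a = a * eigenCasimir r a P Q := by
  have h0 := root_eq hr
  obtain ⟨⟨a1, a2⟩, ⟨p1, -⟩, ⟨-, q2⟩, -, -⟩ := h.assoc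
  simp only [eigenCasimir, mul_sub, sub_mul, smul_mul_assoc, mul_smul_comm, p1, q2,
    mul_assoc, a1, a2, smul_smul]
  match_scalars <;> grind

theorem EigenCore.commute_P {a P Q : T} (hr : IsPrimitiveRoot r 3) (h : EigenCore r a P Q) :
    eigenCasimir r a P Q * P = P * eigenCasimir r a P Q := by
  have h0 := root_eq hr
  obtain ⟨⟨-, a2⟩, ⟨p1, p2⟩, -, ⟨-, pq2⟩, -⟩ := h.assoc
  simp only [eigenCasimir, mul_add, mul_sub, sub_mul, smul_mul_assoc, mul_smul_comm, p1, p2, pq2,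
    mul_assoc, a2, smul_sub, smul_add, smul_smul]
  match_scalars <;> field_simp <;> grind

theorem EigenCore.commute_Q {a P Q : T} (hr : IsPrimitiveRoot r 3) (h : EigenCore r a P Q) :
    eigenCasimir r a P Q * Q = Q * eigenCasimir r a P Q := by
  have h0 := root_eq hr
  obtain ⟨⟨-, a2⟩, -, ⟨q1, q2⟩, ⟨pq1, -⟩, -⟩ := h.assoc
  simp only [eigenCasimir, mul_add, mul_sub, sub_mul, smul_mul_assoc, mul_smul_comm, mul_one,
    q1, q2, pq1, mul_assoc, a2, smul_sub, smul_add, smul_smul]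
  match_scalars <;> field_simp <;> grind

theorem EigenCore.casimir_cube {a P Q : T} (hr : IsPrimitiveRoot r 3) (h : EigenCore r a P Q) :
    (eigenCasimir r a P Q - (1 / 3 : k) • 1) *
      ((eigenCasimir r a P Q - (1 / 3 : k) • 1) * (eigenCasimir r a P Q + (2 / 3 : k) • 1)) =
      0 := by
  have h0 := root_eq hr
  obtain ⟨⟨a1, a2⟩, ⟨p1, p2⟩, ⟨-, q2⟩, ⟨-, pq2⟩, ⟨-, qq2⟩⟩ := h.assoc
  simp only [eigenCasimir, mul_add, mul_sub, sub_mul, smul_mul_assoc, mul_smul_comm, mul_one,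
    one_mul, p1, p2, q2, pq2, qq2, mul_zero, smul_zero, mul_assoc, a1, a2, smul_sub, smul_add,
    smul_smul]
  match_scalars <;> field_simp <;> grind

end Casimir

section Casimir

variable {k : Type u} [Field k] {r : k} (hr : IsPrimitiveRoot r 3)

theorem A.casimir_eq : A.casimir hr = eigenCasimir r (A.a hr) (A.P hr) (A.Q hr) := by
  have h0 := root_eq hr
  obtain ⟨⟨a1, -⟩, ⟨-, p2⟩, -, ⟨pq1, -⟩, -⟩ := (A.eigen hr).assoc
  have h2 : r ^ 2 - r = -(r * (1 - r)) := by ring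
  have h2' : r - r ^ 2 = r * (1 - r) := by ring
  rw [A.casimir, A.E_eq, A.F_eq, A.K, eigenCasimir, h2, h2']
  simp only [pow_two (_ : A hr), mul_one, mul_add, mul_sub, smul_mul_assoc, mul_smul_comm, p2, pq1,
    mul_assoc, a1, smul_add, smul_sub, smul_smul]
  match_scalars <;> field_simp <;> grind

theorem A.casimir_mem_center : A.casimir hr ∈ Subalgebra.center k (A hr) := by
  have h := A.eigen hr
  rw [A.casimir_eq, Subalgebra.mem_center_iff]
  have hP : Commute _ _ := h.commute_P hr
  have hQ : Commute _ _ := h.commute_Q hr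
  have ha : Commute _ _ := h.commute_a hr
  have key : ∀ z, Commute z (A.a hr) → Commute z (A.P hr) → Commute z (A.Q hr) →
      Commute z (eigenCasimir r (A.a hr) (A.P hr) (A.Q hr)) := fun z za zP zQ =>
    (((za.mul_right (za.mul_right (zQ.mul_right zP))).smul_right _).sub_right
      ((za.mul_right za).smul_right _)).sub_right (za.smul_right _)
  intro z
  change Commute z _
  induction z using A.induction hr with
  | hc c => exact Algebra.commutes c _
  | ha => exact ha.symm
  | hb => exact key _ h.ba h.bP h.bQ
  | hx =>
    rw [A.x_eq]
    exact (((ha.symm.sub_left (Commute.one_left _)).smul_left _).add_left hP.symm).add_left hQ.symm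
  | hy => exact key _ h.ya h.yP h.yQ
  | hmul s t hs ht => exact hs.mul_left ht
  | hadd s t hs ht => exact hs.add_left ht

open Matrix in
/-- Multiplication by `Ω - 1/3` preserves the block of the coordinates at the elements `Qˡ e₀`. -/
theorem A.coord_mul_casimir_sub (u : A hr) :
    A.coord hr (u * (A.casimir hr - (1 / 3 : k) • 1)) 0 0 =
      (3 * r) • (hMatrix r (CubicRing.s k) 1 *ᵥ (shiftMatrix _ *ᵥ A.coord hr u 0 0)) := by
  have h0 := root_eq hr
  have hμ : rootPow r 0 = 1 := pow_zero r
  have hz : (0 : ZMod 3) + 1 + -1 = 0 := by decide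
  rw [A.coord_mul, A.casimir_eq, eigenCasimir]
  simp only [map_sub, map_smul, map_mul, map_one, MulOpposite.unop_sub, MulOpposite.unop_smul,
    MulOpposite.unop_mul, MulOpposite.unop_one, A.rho_a, A.rho_P, A.rho_Q, LinearMap.sub_apply,
    LinearMap.smul_apply, Module.End.mul_apply, Module.End.one_apply, Pi.sub_apply, Pi.smul_apply,
    opA, opP, opQ, blockOp_apply, hμ, one_smul, one_mulVec, add_zero, hz]
  match_scalars
  field_simp
  grind

/-- The elements `1`, `Ω - 1/3` and `(Ω - 1/3)²` are linearly independent: this is visible in the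
coordinates at `e₀`, `Q e₀` and `Q² e₀`. -/
theorem A.casimir_independent {d₀ d₁ d₂ : k}
    (h : d₀ • 1 + d₁ • (A.casimir hr - (1 / 3 : k) • 1) +
      d₂ • ((A.casimir hr - (1 / 3 : k) • 1) * (A.casimir hr - (1 / 3 : k) • 1)) = 0) :
    d₀ = 0 ∧ d₁ = 0 ∧ d₂ = 0 := by
  have h1 := A.coord_mul_casimir_sub hr 1
  have h2 := A.coord_mul_casimir_sub hr (A.casimir hr - (1 / 3 : k) • 1)
  rw [one_mul] at h1
  have := congrFun (congrFun (congrArg (A.coord hr) h) 0) 0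
  have hzero : A.coord hr 0 = 0 := by simp [A.coord]
  simp only [hzero, Pi.zero_apply, A.coord_add, A.coord_smul, A.coord_one, Pi.add_apply,
    Pi.smul_apply, h2, h1] at this
  have e0 := congrFun this 0
  have e1 := congrFun this 1
  have e2 := congrFun this 2
  simp [coordOne, hMatrix, shiftMatrix, Matrix.vecHead, Matrix.vecTail] at e0 e1 e2
  have h0 := root_eq hr
  have h3 := three_ne hr
  -- At the singular point, the coordinate at `Q e₀` only says that `d₁ = d₂`.
  have hd : d₁ = d₂ := by
    have e := congrArg CubicRing.eval₀ e1
    simp only [map_add, map_mul, map_smul, CubicRing.eval₀_s, AlgHom.commutes,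
      Algebra.algebraMap_self_apply, smul_eq_mul, mul_zero, map_one, map_sub, map_pow,
      map_zero] at e
    field_simp at e
    grind
  subst hd
  obtain ⟨θ, R, hθ, hR, hR', hθ', -⟩ := algebraMap_consts (B := CubicRing k) hr
  have hsm : ∀ (c : k) (z : CubicRing k), c • z = algebraMap k _ c * z :=
    fun c z => Algebra.smul_def c z
  simp only [hsm, map_mul, div_eq_mul_inv, hθ', ← hR, map_ofNat, map_pow, map_sub,
    map_one] at e2
  -- With `d₁ = d₂`, the coordinate at `Q² e₀` is a multiple of `s (s + 1)`.
  have hs : CubicRing.s k * (algebraMap k _ d₁ * (CubicRing.s k + 1)) = 0 := by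
    clear * - e2 hθ hR'
    generalize algebraMap k (CubicRing k) d₁ = D at *
    generalize CubicRing.s k = S at *
    have h9 : 9 * (S * (D * (S + 1))) = 0 := by grind
    linear_combination θ ^ 2 * h9 - S * (D * (S + 1)) * (3 * θ + 1) * hθ
  have hd : d₁ = 0 := by
    simpa using congrArg CubicRing.eval₀ (CubicRing.eq_zero_of_s_mul hs)
  exact ⟨e0.resolve_right fun h => by simpa using congrArg CubicRing.eval₀ h, hd, hd⟩

theorem A.minpoly_casimir :
    minpoly k (A.casimir hr) = (.X - .C (1 / 3)) ^ 2 * (.X + .C (2 / 3)) := by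
  have hcube := (A.eigen hr).casimir_cube hr
  rw [← A.casimir_eq] at hcube
  symm
  refine minpoly.unique k _ (by monicity!) ?_ fun q hq hqz => ?_
  · simpa [pow_two, mul_assoc, Algebra.algebraMap_eq_smul_one] using hcube
  · by_contra hlt
    -- The Taylor expansion of `q` at `1/3` turns a relation of degree at most two for `Ω` into a
    -- linear dependence between `1`, `Ω - 1/3` and `(Ω - 1/3)²`.
    set p := q.comp (.X + .C (1 / 3)) with hp
    have hpz : Polynomial.aeval (A.casimir hr - (1 / 3 : k) • 1) p = 0 := by
      rw [hp, Polynomial.aeval_comp, map_add, Polynomial.aeval_X, Polynomial.aeval_C,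
        Algebra.algebraMap_eq_smul_one, sub_add_cancel, hqz]
    have hd : p.natDegree < 3 := by
      have h3 : ((.X - .C (1 / 3)) ^ 2 * (.X + .C (2 / 3)) : Polynomial k).degree = 3 := by
        compute_degree!
      rw [h3, not_le] at hlt
      rw [hp, Polynomial.natDegree_comp, Polynomial.natDegree_X_add_C, mul_one]
      exact (Polynomial.natDegree_lt_iff_degree_lt hq.ne_zero).mpr hlt
    have hpne : p ≠ 0 := (hq.comp_X_add_C _).ne_zero
    rw [Polynomial.aeval_eq_sum_range' hd] at hpz
    simp only [Finset.sum_range_succ, Finset.range_zero, Finset.sum_empty, zero_add, pow_zero,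
      pow_one, pow_two] at hpz
    obtain ⟨h0, h1, h2⟩ := A.casimir_independent hr hpz
    refine hpne (Polynomial.ext fun n => ?_)
    match n with
    | 0 => exact h0
    | 1 => exact h1
    | 2 => exact h2
    | n + 3 => exact Polynomial.coeff_eq_zero_of_natDegree_lt (by omega)

theorem A.nilpotent_ne_zero : (A.casimir hr - algebraMap k _ (1 / 3)) *
    (A.casimir hr + algebraMap k _ (2 / 3)) ≠ 0 := by
  intro h
  -- The product is `(Ω - 1/3)² + (Ω - 1/3)`.
  refine one_ne_zero (A.casimir_independent hr (d₀ := 0) (d₁ := 1) (d₂ := 1) ?_).2.2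
  rw [← h]
  simp only [Algebra.algebraMap_eq_smul_one]
  have h3 := three_ne hr
  simp only [sub_mul, mul_sub, mul_add, smul_mul_assoc, mul_smul_comm, one_mul, mul_one]
  match_scalars <;> field_simp <;> ring

theorem A.nilpotent_sq : ((A.casimir hr - algebraMap k _ (1 / 3)) *
    (A.casimir hr + algebraMap k _ (2 / 3))) ^ 2 = 0 := by
  have h := (A.eigen hr).casimir_cube hr
  rw [← A.casimir_eq, ← Algebra.algebraMap_eq_smul_one, ← Algebra.algebraMap_eq_smul_one] at h
  have hc : Commute (A.casimir hr - algebraMap k _ (1 / 3))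
      (A.casimir hr + algebraMap k _ (2 / 3)) := by
    refine (Commute.add_right ?_ (Algebra.commutes _ _).symm)
    exact (Commute.refl _).sub_left (Algebra.commutes _ _)
  rw [hc.mul_pow, pow_two, pow_two, ← mul_assoc, mul_assoc (A.casimir hr - _), h, zero_mul]

/-- A central square-zero element generates a nilpotent two-sided ideal. -/
theorem span_singleton_isTwoSided_isNilpotent {R : Type*} [Ring R] {z : R}
    (hz : ∀ u, u * z = z * u) (h2 : z ^ 2 = 0) :
    (Ideal.span {z}).IsTwoSided ∧ IsNilpotent (Ideal.span {z}) := by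
  refine ⟨⟨fun {u} v hu => ?_⟩, 2, ?_⟩
  · obtain ⟨w, rfl⟩ := Ideal.mem_span_singleton'.mp hu
    exact Ideal.mem_span_singleton'.mpr ⟨w * v, by rw [mul_assoc, hz v, mul_assoc]⟩
  · rw [Submodule.pow_succ, Submodule.pow_one, Submodule.zero_eq_bot, eq_bot_iff, Ideal.mul_le]
    intro u hu v hv
    obtain ⟨u, rfl⟩ := Ideal.mem_span_singleton'.mp hu
    obtain ⟨v, rfl⟩ := Ideal.mem_span_singleton'.mp hv
    rw [← mul_assoc, mul_assoc u, ← hz v, mul_assoc, mul_assoc v, ← pow_two, h2, mul_zero,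
      mul_zero]
    exact zero_mem _

/-- The element `(Ω - 1/3)(Ω + 2/3)` generates a nonzero nilpotent two-sided ideal. -/
theorem A.span_nilpotent :
    letI I : Ideal (A hr) := Ideal.span {(A.casimir hr - algebraMap k (A hr) (1 / 3)) *
      (A.casimir hr + algebraMap k (A hr) (2 / 3))}
    I.IsTwoSided ∧ I ≠ ⊥ ∧ IsNilpotent I := by
  have hc := Subalgebra.mul_mem _
    (Subalgebra.sub_mem _ (A.casimir_mem_center hr) (Subalgebra.algebraMap_mem _ (1 / 3)))
    (Subalgebra.add_mem _ (A.casimir_mem_center hr) (Subalgebra.algebraMap_mem _ (2 / 3)))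
  obtain ⟨h1, h2⟩ := span_singleton_isTwoSided_isNilpotent
    (fun u => Subalgebra.mem_center_iff.mp hc u) (A.nilpotent_sq hr)
  exact ⟨h1, fun h => A.nilpotent_ne_zero hr (Ideal.span_singleton_eq_bot.mp h), h2⟩

end Casimir


/-! ### Consequences of freeness over the coordinate ring -/

section Free

variable {k : Type u} [Field k]

/-- A one-dimensional module of a ring `R` that is projective over the coordinate ring of the cubic
has infinite projective dimension as soon as it restricts to the residue field of the singular
point. -/
theorem projectiveDimension_charModule {R : Type u} [Ring R] (φ : CubicRing k →+* R)
    (hφ : letI := φ.toModule; Module.Projective (CubicRing k) R) (ε : R →+* k)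
    (hε : ∀ β, ε (φ β) = CubicRing.eval₀ β) :
    projectiveDimension ((ModuleCat.restrictScalars φ).obj (charModule ε)) = ⊤ ∧
      projectiveDimension (charModule ε) = ⊤ := by
  have h : projectiveDimension ((ModuleCat.restrictScalars φ).obj (charModule ε)) = ⊤ := by
    let π : CubicRing k →ₗ[CubicRing k] ((ModuleCat.restrictScalars φ).obj (charModule ε)) :=
      { toFun := fun β => (CubicRing.eval₀ β : k)
        map_add' := fun β γ => map_add _ β γ
        map_smul' := fun β γ => by
          change CubicRing.eval₀ (β * γ) = ε (φ β) * CubicRing.eval₀ γ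
          rw [map_mul, hε] }
    refine CubicRing.projectiveDimension_residueField π ?_ ?_
    · exact fun (c : k) => ⟨algebraMap k (CubicRing k) c, AlgHom.commutes CubicRing.eval₀ c⟩
    · rfl
  refine ⟨h, ?_⟩
  rw [projectiveDimension_eq_top_iff'] at h ⊢
  exact fun n _ => h n (hasProjectiveDimensionLT_restrictScalars φ hφ n _)

theorem not_hasFiniteGlobalDimension {R : Type u} [Ring R] {M : ModuleCat.{u} R}
    (hM : projectiveDimension M = ⊤) : ¬ HasFiniteGlobalDimension R := fun ⟨n, h⟩ =>
  (projectiveDimension_eq_top_iff' M).mp hM (n + 1) (h M)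

end Free

section Applications

variable {k : Type u} [Field k] {r : k} (hr : IsPrimitiveRoot r 3)

theorem A.isNoetherianRing : IsNoetherianRing (A hr) := by
  let _ := (A.cubicHom hr).toRingHom.toModule
  have : Module.Finite (CubicRing k) (A hr) := .of_basis (A.cubicBasis hr)
  have : IsScalarTower (CubicRing k) (A hr) (A hr) := ⟨fun β u v => mul_assoc _ u v⟩
  exact isNoetherian_of_tower (CubicRing k) inferInstance

theorem A.isNoetherianRing_opposite : IsNoetherianRing (A hr)ᵐᵒᵖ :=
  have := A.isNoetherianRing (sq_primitive hr)
  isNoetherianRing_of_ringEquiv _ (A.revEquiv hr).toRingEquiv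

theorem A.projective :
    letI := (A.cubicHom hr).toRingHom.toModule
    Module.Projective (CubicRing k) (A hr) :=
  letI := (A.cubicHom hr).toRingHom.toModule
  .of_basis (A.cubicBasis hr)

theorem A.projective_opposite :
    letI := ((A.revEquiv hr).toAlgHom.comp (A.cubicHom (sq_primitive hr))).toRingHom.toModule
    Module.Projective (CubicRing k) (A hr)ᵐᵒᵖ := by
  let _ := (A.cubicHom (sq_primitive hr)).toRingHom.toModule
  let _ := ((A.revEquiv hr).toAlgHom.comp (A.cubicHom (sq_primitive hr))).toRingHom.toModule
  have := A.projective (sq_primitive hr)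
  let e : A (sq_primitive hr) ≃ₗ[CubicRing k] (A hr)ᵐᵒᵖ :=
    { (A.revEquiv hr).toRingEquiv.toAddEquiv with
      map_smul' := fun β u => map_mul (A.revEquiv hr) _ u }
  exact .of_equiv e

theorem A.counit_x : A.counit hr (A.x hr) = 0 := by simp [A.counit]

theorem A.counit_y : A.counit hr (A.y hr) = 0 := by simp [A.counit]

theorem A.counit_cubicHom (β : CubicRing k) :
    A.counit hr (A.cubicHom hr β) = CubicRing.eval₀ β := by
  induction β using CubicRing.induction with
  | hc c => rw [AlgHom.commutes, AlgHom.commutes, AlgHom.commutes]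
  | hs β _ => rw [map_mul, map_mul, map_mul, A.cubicHom_s, A.counit_x, CubicRing.eval₀_s, mul_zero,
      mul_zero]
  | ht β _ => rw [map_mul, map_mul, map_mul, A.cubicHom_t, A.counit_y, CubicRing.eval₀_t, mul_zero,
      mul_zero]
  | hadd β γ h₁ h₂ => rw [map_add, map_add, map_add, h₁, h₂]

theorem A.counit_unop_revEquiv (u : A (sq_primitive hr)) :
    A.counit hr (A.revEquiv hr u).unop = A.counit (sq_primitive hr) u := by
  induction u using A.induction with
  | hc c => rw [AlgEquiv.commutes, AlgHom.commutes]; exact AlgHom.commutes _ c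
  | ha => simp [A.counit, A.revEquiv]
  | hb => simp [A.counit, A.revEquiv]
  | hx => simp [A.counit, A.revEquiv]
  | hy => simp [A.counit, A.revEquiv]
  | hmul u v hu hv => rw [map_mul, MulOpposite.unop_mul, map_mul, map_mul, hu, hv, mul_comm]
  | hadd u v hu hv => rw [map_add, MulOpposite.unop_add, map_add, map_add, hu, hv]

theorem A.gkDim_eq_one : gkDim k (A hr) = 1 := by
  set f := (A.cubicHom hr).comp (Polynomial.aeval (CubicRing.s k)) with hf
  refine le_antisymm ?_ (one_le_gkDim f
    ((A.cubicHom_injective hr).comp CubicRing.aeval_s_injective))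
  -- over the subalgebra `k[x]`, the elements `w` and `y w` generate `A`, for `w` in the basis
  let g : Fin 2 × ZMod 3 × Fin 3 → Bool → A hr := fun j c =>
    if c then A.y hr * A.basisElem hr j else A.basisElem hr j
  let e := Fintype.equivFin ((Fin 2 × ZMod 3 × Fin 3) × Bool)
  refine gkDim_le_one f (fun n => g (e.symm n).1 (e.symm n).2) fun z => ?_
  let _ := (A.cubicHom hr).toRingHom.toModule
  choose p q hpq using fun j => CubicRing.exists_eq ((A.cubicBasis hr).repr z j)
  refine ⟨fun n => if (e.symm n).2 then q (e.symm n).1 else p (e.symm n).1, ?_⟩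
  rw [e.symm.sum_comp fun i => f (if i.2 then q i.1 else p i.1) * g i.1 i.2,
    Fintype.sum_prod_type]
  refine Eq.trans ?_ ((A.cubicBasis hr).sum_repr z)
  refine Finset.sum_congr rfl fun j _ => ?_
  have hb : A.cubicBasis hr j = A.basisElem hr j := Module.Basis.mk_apply ..
  rw [hb, hpq j, Fintype.sum_bool]
  change A.cubicHom hr (Polynomial.aeval (CubicRing.s k) (q j)) * (A.y hr * A.basisElem hr j) +
    A.cubicHom hr (Polynomial.aeval (CubicRing.s k) (p j)) * A.basisElem hr j =
    A.cubicHom hr _ * A.basisElem hr j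
  rw [map_add, map_mul, A.cubicHom_t, add_mul, mul_assoc, add_comm]

theorem A.projectiveDimension_trivialModule :
    projectiveDimension ((ModuleCat.restrictScalars (A.cubicHom hr).toRingHom).obj
      (trivialModule hr)) = ⊤ ∧ projectiveDimension (trivialModule hr) = ⊤ :=
  projectiveDimension_charModule _ (A.projective hr) _ (A.counit_cubicHom hr)

theorem A.projectiveDimension_trivialRightModule :
    projectiveDimension (trivialRightModule hr) = ⊤ :=
  (projectiveDimension_charModule _ (A.projective_opposite hr) _ fun β =>
    (A.counit_unop_revEquiv hr _).trans (A.counit_cubicHom (sq_primitive hr) β)).2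

end Applications

end NodalCubic

theorem mainTheorem2 {k : Type u} [Field k] {r : k} (hr : IsPrimitiveRoot r 3) :
    -- `A` is Noetherian (on both sides), of Gelfand-Kirillov dimension one
    (IsNoetherianRing (A hr) ∧ IsNoetherianRing (A hr)ᵐᵒᵖ) ∧
    gkDim k (A hr) = 1 ∧
    -- `A` is not regular (on either side)
    (¬ HasFiniteGlobalDimension (A hr) ∧ ¬ HasFiniteGlobalDimension (A hr)ᵐᵒᵖ) ∧
    -- `A` is not semiprime
    ¬ IsSemiprimeRing (A hr) ∧
    -- the trivial modules have infinite projective dimension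
    projectiveDimension (trivialModule hr) = ⊤ ∧
    projectiveDimension (trivialRightModule hr) = ⊤ ∧
    -- this comes from the singular point `(0, 0)` of the cubic
    (∃ φ : CubicRing k →ₐ[k] A hr,
      φ (CubicRing.mk k (.X 0)) = A.x hr ∧ φ (CubicRing.mk k (.X 1)) = A.y hr ∧
      Function.Injective φ ∧
      (∀ f : MvPolynomial (Fin 2) k,
        Coalgebra.counit (R := k) (φ (CubicRing.mk k f)) = MvPolynomial.eval 0 f) ∧
      projectiveDimension
        ((ModuleCat.restrictScalars φ.toRingHom).obj (trivialModule hr)) = ⊤) ∧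
    -- the Casimir element
    A.casimir hr ∈ Subalgebra.center k (A hr) ∧
    minpoly k (A.casimir hr) = (.X - .C (1 / 3)) ^ 2 * (.X + .C (2 / 3)) ∧
    -- and the nonzero nilpotent ideal that it yields
    (∃ I : Ideal (A hr),
      I = Ideal.span {(A.casimir hr - algebraMap k (A hr) (1 / 3)) *
        (A.casimir hr + algebraMap k (A hr) (2 / 3))} ∧
      I.IsTwoSided ∧ I ≠ ⊥ ∧ IsNilpotent I) := by
  have hpd := A.projectiveDimension_trivialModule hr
  have hpd' := A.projectiveDimension_trivialRightModule hr
  have hI := A.span_nilpotent hr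
  refine ⟨⟨A.isNoetherianRing hr, A.isNoetherianRing_opposite hr⟩, A.gkDim_eq_one hr,
    ⟨not_hasFiniteGlobalDimension hpd.2, not_hasFiniteGlobalDimension hpd'⟩,
    fun h => hI.2.1 (h _ hI.1 hI.2.2), hpd.2, hpd',
    ⟨A.cubicHom hr, A.cubicHom_s hr, A.cubicHom_t hr, A.cubicHom_injective hr, fun f => ?_, hpd.1⟩,
    A.casimir_mem_center hr, A.minpoly_casimir hr, ⟨_, rfl, hI⟩⟩
  exact (A.counit_cubicHom hr _).trans (CubicRing.eval₀_mk f)
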